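/- Let $n\ge 3$, let $M$ be an oriented smooth $n$-dimensional manifold, possibly with boundary, with boundary inclusion $j:\partial M\to M$, let $\hat g$ be a smooth Riemannian metric on $M$, and let $\beta$ be a smooth $(n-1)$-form on $M$ with $d\beta=0$ and $j^*\beta=\beta_{\partial M}$ for a given $(n-1)$-form $\beta_{\partial M}$ on $\partial M$. Let $U=\{p\in M:\beta_p\neq 0\}$ be the open set on which $\beta$ does not vanish, and let $\bar g=|\beta|_{\hat g}^2\,\hat g$, a Riemannian metric on $U$. For a Riemannian metric $g$ on $U$ with volume form $\mu$, Hodge star $\star$, Levi-Civita connection $\nabla$ and induced norm $|\cdot|$ on forms, let $B$ be the vector field on $U$ with $\iota_B\mu=\beta$. A normalization of a form $\alpha$ on $U$ is a form $\xi$ on $U$ of the same degree with $|\alpha|\,\xi=\alpha$ and $|\xi|\le 1$. With respect to $g$, the form $\beta$ is called, on $U$, - force-free if $\iota_B\, d{\star}\beta=0$; - geodesic if $\nabla_BB=\rho B$ for some $\rho\in C^\infty(U)$; - harmonic if $d{\star}\beta=0$, and exact harmonic if $\beta=\star\, d\varphi$ for some $\varphi\in C^\infty(U)$; - eikonal if $\star\beta$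 has a smooth closed normalization $\eta\in\Omega^1(U)$, and exact eikonal if $\star\beta$ has a normalization of the form $\eta=d\varphi$ with $\varphi\in C^\infty(U)$. Then, on $U$: 1. $\beta$ is force-free with respect to $\hat g$ if and only if it is geodesic with respect to $\bar g$. 2. $\beta$ is harmonic with respect to $\hat g$ if and only if it is eikonal with respect to $\bar g$. 3. $\beta$ is exact harmonic with respect to $\hat g$ if and only if it is exact eikonal with respect to $\bar g$. -/

import Mathlib

open Set Filter Topology Function
open scoped Manifold ContDiff BigOperators Matrix

namespace FluxForm

noncomputable section

/-! ## Linear algebra on one tangent space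

The tangent space of an `n`-dimensional manifold at a point is a copy of `ℝⁿ`. It carries a
scalar product `g` (a positive definite symmetric bilinear form, not the Euclidean one) and an
orientation `o`. -/

/-- The space `ℝⁿ`. -/
abbrev Euc (n : ℕ) : Type := EuclideanSpace ℝ (Fin n)

/-- The standard basis of `ℝⁿ`. -/
def stdBasis (n : ℕ) : Module.Basis (Fin n) ℝ (Euc n) :=
  (EuclideanSpace.basisFun (Fin n) ℝ).toBasis

/-- The determinant with respect to the standard basis, as a continuous alternating form. -/
def detForm (n : ℕ) : Euc n [⋀^Fin n]→L[ℝ] ℝ :=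
  { (stdBasis n).det with
    cont := by
      have h : Continuous fun v : Fin n → Euc n => Matrix.det (Matrix.of fun i j => v j i) := by
        fun_prop
      refine h.congr fun v => ?_
      change _ = (stdBasis n).det v
      rw [Module.Basis.det_apply]
      congr 1 }

variable {n : ℕ}

/-- The matrix `g_{ij} = g(b_i, b_j)` of `g` in the standard basis. -/
def gram (g : Euc n →L[ℝ] Euc n →L[ℝ] ℝ) : Matrix (Fin n) (Fin n) ℝ :=
  Matrix.of fun i j => g (stdBasis n i) (stdBasis n j)

/-- The basis `bⁱ = ∑ⱼ gⁱʲ bⱼ` that is reciprocal to the standard basis: `g(bⁱ, bⱼ) = δⁱⱼ`. -/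
def recip (g : Euc n →L[ℝ] Euc n →L[ℝ] ℝ) (i : Fin n) : Euc n :=
  ∑ j, (gram g)⁻¹ i j • stdBasis n j

open Classical in
/-- The volume form of `g` and `o`: it equals `√(det g_{ij}) dx¹ ∧ ⋯ ∧ dxⁿ` if the standard basis
is positively oriented, and minus this form otherwise. -/
def volForm (g : Euc n →L[ℝ] Euc n →L[ℝ] ℝ) (o : Orientation ℝ (Euc n) (Fin n)) :
    Euc n [⋀^Fin n]→L[ℝ] ℝ :=
  (if (stdBasis n).orientation = o then Real.sqrt (gram g).det else -Real.sqrt (gram g).det) •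
    detForm n

/-- `contract u α = α(u₀, …, u_{k-1}, ·, …, ·)`: the vectors `u` are inserted into the first `k`
slots of `α`. -/
def contract {l : ℕ} : (k : ℕ) → (Fin k → Euc n) → (Euc n [⋀^Fin (l + k)]→L[ℝ] ℝ) →
    (Euc n [⋀^Fin l]→L[ℝ] ℝ)
  | 0, _, α => α
  | k + 1, u, α => contract k (Fin.tail u) (α.curryLeft (u 0))

/-- A `k`-form regarded as an `l`-form, when `k = l`. -/
def castForm {k l : ℕ} (h : k = l) (α : Euc n [⋀^Fin k]→L[ℝ] ℝ) : Euc n [⋀^Fin l]→L[ℝ] ℝ :=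
  { α.toAlternatingMap.domDomCongr (finCongr h) with
    cont := by
      change Continuous fun v : Fin l → Euc n => α fun i => v (finCongr h i)
      exact α.cont.comp (by fun_prop) }

/-- The Hodge star `⋆ : Λᵏ → Λˡ`, `k + l = n`, of `g` and `o`, by the coordinate formula
`⋆α = (1/k!) ∑ α^{i₁…i_k} μ(b_{i₁}, …, b_{i_k}, ·, …, ·)`, where `μ` is the volume form and
`α^{i₁…i_k} = α(b^{i₁}, …, b^{i_k})` are the components of `α` with raised indices. -/
def starForm {k l : ℕ} (h : n = l + k) (g : Euc n →L[ℝ] Euc n →L[ℝ] ℝ)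
    (o : Orientation ℝ (Euc n) (Fin n)) (α : Euc n [⋀^Fin k]→L[ℝ] ℝ) :
    Euc n [⋀^Fin l]→L[ℝ] ℝ :=
  ((k.factorial : ℝ)⁻¹) • ∑ f : Fin k → Fin n,
    α (fun a => recip g (f a)) •
      contract k (fun a => stdBasis n (f a)) (castForm h (volForm g o))

/-- The squared norm `|α|² = (1/k!) ∑ α^{i₁…i_k} α_{i₁…i_k}` of a `k`-form. -/
def formNormSq {k : ℕ} (g : Euc n →L[ℝ] Euc n →L[ℝ] ℝ) (α : Euc n [⋀^Fin k]→L[ℝ] ℝ) : ℝ :=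
  ((k.factorial : ℝ)⁻¹) * ∑ f : Fin k → Fin n,
    α (fun a => recip g (f a)) * α (fun a => stdBasis n (f a))

/-- The norm `|α|` of a `k`-form. -/
def formNorm {k : ℕ} (g : Euc n →L[ℝ] Euc n →L[ℝ] ℝ) (α : Euc n [⋀^Fin k]→L[ℝ] ℝ) : ℝ :=
  Real.sqrt (formNormSq g α)

/-- The vector `B` with `ι_B μ = β`, where `μ` is the volume form of `g` and `o`. -/
def assocVector {m : ℕ} (g : Euc (m + 1) →L[ℝ] Euc (m + 1) →L[ℝ] ℝ)
    (o : Orientation ℝ (Euc (m + 1)) (Fin (m + 1))) (β : Euc (m + 1) [⋀^Fin m]→L[ℝ] ℝ) :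
    Euc (m + 1) :=
  Function.invFun (fun v => (volForm g o).curryLeft v) β

/-! ## Tensor fields on a manifold -/

section Manifold

variable {H : Type*} [TopologicalSpace H] (I : ModelWithCorners ℝ (Euc n) H)
  (M : Type*) [TopologicalSpace M] [ChartedSpace H M]

/-- Fields of alternating `k`-forms on `M`. Smoothness is the separate predicate `SmoothOn`. -/
abbrev DForm (k : ℕ) := (x : M) → TangentSpace I x [⋀^Fin k]→L[ℝ] ℝ

/-- Vector fields on `M`. -/
abbrev VField := (x : M) → TangentSpace I x

/-- Fields of bilinear forms on `M`, such as Riemannian metrics. -/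
abbrev BilinField := (x : M) → TangentSpace I x →L[ℝ] TangentSpace I x →L[ℝ] ℝ

/-- An orientation of `M`: an orientation of each tangent space which, read in the chart at `x₀`,
is constant near `x₀`. -/
structure TangentOrientation where
  /-- The orientation of the tangent space at `x`. -/
  orient : (x : M) → Orientation ℝ (TangentSpace I x) (Fin n)
  locallyConstant : ∀ x₀ : M, ∃ s : Orientation ℝ (Euc n) (Fin n), ∀ᶠ x in 𝓝 x₀,
    ∃ A : TangentSpace I x ≃L[ℝ] Euc n,
      (A : TangentSpace I x →L[ℝ] Euc n) = mfderiv I 𝓘(ℝ, Euc n) (extChartAt I x₀) x ∧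
        Orientation.map (Fin n) A.toLinearEquiv (orient x) = s

variable {I M}

/-- The derivative at `z` of the inverse of the chart at `x₀`: it sends a coordinate vector at `z`
to the tangent vector of `M` that it represents. -/
def chartInvDeriv (x₀ : M) (z : Euc n) :
    Euc n →L[ℝ] TangentSpace I ((extChartAt I x₀).symm z) :=
  mfderivWithin 𝓘(ℝ, Euc n) I (extChartAt I x₀).symm (range I) z

/-- The derivative at `x` of the chart at `x`. -/
def chartDeriv (x : M) : TangentSpace I x →L[ℝ] Euc n :=
  mfderiv I 𝓘(ℝ, Euc n) (extChartAt I x) x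

/-- The form `α` in the coordinates of the chart at `x₀`. -/
def formInChart {k : ℕ} (x₀ : M) (α : DForm I M k) (z : Euc n) : Euc n [⋀^Fin k]→L[ℝ] ℝ :=
  (α ((extChartAt I x₀).symm z)).compContinuousLinearMap (chartInvDeriv x₀ z)

/-- The bilinear form field `g` in the coordinates of the chart at `x₀`. -/
def bilinInChart (x₀ : M) (g : BilinField I M) (z : Euc n) : Euc n →L[ℝ] Euc n →L[ℝ] ℝ :=
  let G : Euc n →L[ℝ] Euc n →L[ℝ] ℝ := g ((extChartAt I x₀).symm z)
  let A : Euc n →L[ℝ] Euc n := chartInvDeriv (I := I) x₀ z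
  G.bilinearComp A A

/-- The vector field `X` in the coordinates of the chart at `x₀`. -/
def vectorInChart (x₀ : M) (X : VField I M) (z : Euc n) : Euc n :=
  VectorField.mpullbackWithin 𝓘(ℝ, Euc n) I (extChartAt I x₀).symm X (range I) z

/-- The form `α` is smooth on the open set `U`: in every chart it has smooth coefficients. -/
def SmoothOn {k : ℕ} (α : DForm I M k) (U : Set M) : Prop :=
  ∀ x₀ : M, ContDiffOn ℝ ∞ (formInChart x₀ α)
    ((extChartAt I x₀).target ∩ (extChartAt I x₀).symm ⁻¹' U)

/-- The exterior derivative of a form on `M`, computed at `x` in the chart at `x`. -/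
def extD {k : ℕ} (α : DForm I M k) : DForm I M (k + 1) := fun x =>
  (extDerivWithin (formInChart x α) (range I) (extChartAt I x x)).compContinuousLinearMap
    (chartDeriv x)

/-- The differential `dφ` of a function, as a `1`-form. -/
def dFun (φ : M → ℝ) : DForm I M 1 := fun x =>
  ContinuousAlternatingMap.ofSubsingleton ℝ (TangentSpace I x) ℝ (0 : Fin 1)
    (mvfderiv I φ x)

/-- The Hodge star of a `k`-form on `M`. -/
def hodgeStar {k l : ℕ} (h : n = l + k) (g : BilinField I M) (o : TangentOrientation I M)
    (α : DForm I M k) : DForm I M l := fun x =>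
  starForm h (g x) (o.orient x) (α x)

/-- The interior product `ι_X α`. -/
def interiorProd {k : ℕ} (X : VField I M) (α : DForm I M (k + 1)) : DForm I M k := fun x =>
  ContinuousAlternatingMap.curryLeft (E := Euc n) (α x) (X x)

/-- The Christoffel symbols of the first kind at `x`, in the chart at `x`:
`Γ(u, v, w) = ½ (∂_u g(v, w) + ∂_v g(u, w) - ∂_w g(u, v))`. -/
def christoffel (g : BilinField I M) (x : M) (u v w : Euc n) : ℝ :=
  let D := fderivWithin ℝ (bilinInChart x g) (range I) (extChartAt I x x)
  (1 / 2) * (D u v w + D v u w - D w u v)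

/-- The Levi-Civita derivative `∇_X Y` of the metric `g`, in the chart at `x`:
`∇_X Y = ∂_X Y + Γ(X, Y)`, where `Γ(X, Y) = ∑ₖ Γ(X, Y, b_k) bᵏ`. -/
def leviCivita (g : BilinField I M) (X Y : VField I M) : VField I M := fun x =>
  let z := extChartAt I x x
  let u := vectorInChart x X z
  let v := vectorInChart x Y z
  (chartDeriv x).inverse
    (fderivWithin ℝ (vectorInChart x Y) (range I) z u +
      ∑ k, christoffel g x u v (stdBasis n k) • recip (bilinInChart x g z) k)

/-- The form `ξ` is a normalization of `α` on `U`: `|α| ξ = α` and `|ξ| ≤ 1`. -/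
def IsNormalizationOn {k : ℕ} (g : BilinField I M) (α ξ : DForm I M k) (U : Set M) : Prop :=
  ∀ x ∈ U, formNorm (g x) (α x) • ξ x = α x ∧ formNorm (g x) (ξ x) ≤ 1

end Manifold

/-! ## Flux forms: `(n - 1)`-forms on a manifold of dimension `n = m + 1` -/

section Flux

variable {m : ℕ} {H : Type*} [TopologicalSpace H] {I : ModelWithCorners ℝ (Euc (m + 1)) H}
  {M : Type*} [TopologicalSpace M] [ChartedSpace H M]

/-- The vector field `B` associated to `β`, defined by `ι_B μ = β`. -/
def assocField (g : BilinField I M) (o : TangentOrientation I M) (β : DForm I M m) :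
    VField I M := fun x =>
  assocVector (g x) (o.orient x) (β x)

/-- The `1`-form `⋆β`. -/
def starFlux (g : BilinField I M) (o : TangentOrientation I M) (β : DForm I M m) :
    DForm I M 1 :=
  hodgeStar (Nat.add_comm m 1) g o β

/-- `β` is force-free on `U`: `ι_B d⋆β = 0`. -/
def IsForceFreeOn (g : BilinField I M) (o : TangentOrientation I M) (β : DForm I M m)
    (U : Set M) : Prop :=
  ∀ x ∈ U, interiorProd (assocField g o β) (extD (starFlux g o β)) x = 0

/-- `β` is harmonic on `U`: `d⋆β = 0`. -/
def IsHarmonicOn (g : BilinField I M) (o : TangentOrientation I M) (β : DForm I M m)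
    (U : Set M) : Prop :=
  ∀ x ∈ U, extD (starFlux g o β) x = 0

/-- `β` is exact harmonic on `U`: `β = ⋆dφ` for a smooth function `φ` on `U`. -/
def IsExactHarmonicOn (g : BilinField I M) (o : TangentOrientation I M) (β : DForm I M m)
    (U : Set M) : Prop :=
  ∃ φ : M → ℝ, ContMDiffOn I 𝓘(ℝ, ℝ) ∞ φ U ∧ ∀ x ∈ U, β x = hodgeStar rfl g o (dFun φ) x

/-- `β` is geodesic on `U`: `∇_B B = ρ B` for a smooth function `ρ` on `U`. -/
def IsGeodesicOn (g : BilinField I M) (o : TangentOrientation I M) (β : DForm I M m)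
    (U : Set M) : Prop :=
  ∃ ρ : M → ℝ, ContMDiffOn I 𝓘(ℝ, ℝ) ∞ ρ U ∧
    ∀ x ∈ U, leviCivita g (assocField g o β) (assocField g o β) x = ρ x • assocField g o β x

/-- `β` is eikonal on `U`: `⋆β` has a closed smooth normalization on `U`. -/
def IsEikonalOn (g : BilinField I M) (o : TangentOrientation I M) (β : DForm I M m)
    (U : Set M) : Prop :=
  ∃ η : DForm I M 1, SmoothOn η U ∧ IsNormalizationOn g (starFlux g o β) η U ∧
    ∀ x ∈ U, extD η x = 0

/-- `β` is exact eikonal on `U`: `⋆β` has a normalization `dφ`, with `φ` a smooth function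
on `U`. -/
def IsExactEikonalOn (g : BilinField I M) (o : TangentOrientation I M) (β : DForm I M m)
    (U : Set M) : Prop :=
  ∃ φ : M → ℝ, ContMDiffOn I 𝓘(ℝ, ℝ) ∞ φ U ∧
    IsNormalizationOn g (starFlux g o β) (dFun φ) U

/-- The field `|β|²_g g`; it is a Riemannian metric where `β` does not vanish. -/
def conformalMetric (g : BilinField I M) (β : DForm I M m) : BilinField I M := fun x =>
  formNormSq (g x) (β x) • g x

/-- The set of points at which `β` does not vanish. -/
def nonvanishing (β : DForm I M m) : Set M := {x | β x ≠ 0}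

end Flux

end

end FluxForm

/-! Write g for `ghat.inner`, N = |β|² in g, ḡ = N g, n = m + 1 and η = g(B, ·). Contraction with
the volume form is an isometry from vectors to m-forms (`sum_volForm_curryLeft`), so N = g(B, B) and
⋆β = (-1)ᵐ η (`formNormSq_eq`, `starForm_eq`). The Gram determinant of ḡ is Nⁿ times that of g, so
the vector of β for ḡ is X = l B with l = N^(-n/2) (`assocVector_smul`).

It follows that ⋆β for ḡ is N l times ⋆β for g, and that its ḡ-norm is F = N l. Hence ⋆β for g has
ḡ-norm 1 and is the one and only normalization of ⋆β for ḡ (`isNormalization_iff`). This identifies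
harmonic with eikonal. For the exact versions, β = ⋆θ means ⋆β = (-1)ᵐ θ (`eq_starForm_iff`), so the
potentials correspond under φ ↦ (-1)ᵐ φ.

For the first equivalence, ḡ(X, ·) = F η and ḡ(X, X) = F². In ḡ(∇_X X, ·) = ι_X d(ḡ(X, ·)) + ½
d(ḡ(X, X)) the terms in dF without a factor η cancel, because η(X) = F. What remains is ḡ(∇_X X, ·)
= F l ι_B dη + dF(X) η; `conformal_leviCivita` is this formula in coordinates, divided by N. If ι_B
dη = 0, then ρ = dF(X)/F works. Conversely, if ∇_X X = ρ X, evaluation on B, where ι_B dη vanishes,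
forces ρ = dF(X)/F, and then ι_B dη = 0.

The rest is smoothness up to the boundary. In a chart B is an explicit smooth expression times an
orientation sign, and this sign is locally constant (`TangentOrientation.chartSign_eventually_eq`).
-/

namespace FluxForm

noncomputable section

/-! ### Scalar products, reciprocal bases and the permutation symbol. -/

section LinearAlgebra

variable {n m : ℕ}

/-- `g` is a scalar product. -/
structure IsScalarProduct (g : Euc n →L[ℝ] Euc n →L[ℝ] ℝ) : Prop where
  symm : ∀ v w, g v w = g w v
  pos : ∀ v, v ≠ 0 → 0 < g v v

open Classical in
/-- The sign of an orientation relative to the standard basis. -/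
def orientSign (o : Orientation ℝ (Euc n) (Fin n)) : ℝ :=
  if (stdBasis n).orientation = o then 1 else -1

theorem orientSign_mul_self (o : Orientation ℝ (Euc n) (Fin n)) :
    orientSign o * orientSign o = 1 := by
  unfold orientSign; split_ifs <;> norm_num

theorem volForm_eq (g : Euc n →L[ℝ] Euc n →L[ℝ] ℝ) (o : Orientation ℝ (Euc n) (Fin n)) :
    volForm g o = (orientSign o * Real.sqrt (gram g).det) • detForm n := by
  unfold volForm orientSign; split_ifs <;> simp

theorem detForm_comp (A : Euc n →ₗ[ℝ] Euc n) (v : Fin n → Euc n) :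
    detForm n (fun i => A (v i)) = LinearMap.det A * detForm n v :=
  (stdBasis n).det_comp A v

theorem posDef_gram {g : Euc n →L[ℝ] Euc n →L[ℝ] ℝ} (hg : IsScalarProduct g) :
    (gram g).PosDef := by
  refine Matrix.PosDef.of_dotProduct_mulVec_pos ?_ ?_
  · ext i j
    simp [gram, hg.symm]
  · intro x hx
    have : star x ⬝ᵥ (gram g) *ᵥ x = g (∑ i, x i • stdBasis n i) (∑ i, x i • stdBasis n i) := by
      simp [gram, dotProduct, Matrix.mulVec, Finset.mul_sum, map_sum]
      rw [Finset.sum_comm]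
      refine Finset.sum_congr rfl fun i _ => Finset.sum_congr rfl fun j _ => ?_
      rw [hg.symm]
      ring
    rw [this]
    refine hg.pos _ fun h => hx ?_
    ext i
    have := congrArg (fun v => (stdBasis n).repr v i) h
    simpa [map_sum, Finsupp.single_apply] using this

theorem det_gram_pos {g : Euc n →L[ℝ] Euc n →L[ℝ] ℝ} (hg : IsScalarProduct g) :
    0 < (gram g).det := (posDef_gram hg).det_pos

theorem apply_recip_stdBasis {g : Euc n →L[ℝ] Euc n →L[ℝ] ℝ} (hg : IsScalarProduct g)
    (i j : Fin n) : g (recip g i) (stdBasis n j) = if i = j then 1 else 0 := by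
  have h : ((gram g)⁻¹ * gram g) i j = (1 : Matrix (Fin n) (Fin n) ℝ) i j := by
    rw [Matrix.nonsing_inv_mul _ (det_gram_pos hg).ne'.isUnit]
  rw [Matrix.one_apply] at h
  rw [← h, Matrix.mul_apply]
  simp [recip, gram, map_sum]

theorem eq_of_forall_apply_eq {g : Euc n →L[ℝ] Euc n →L[ℝ] ℝ} (hg : IsScalarProduct g)
    {v w : Euc n} (h : ∀ u, g v u = g w u) : v = w := by
  by_contra hvw
  have h0 : g (v - w) (v - w) = 0 := by rw [map_sub g, sub_apply, h, sub_self]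
  exact (hg.pos (v - w) (sub_ne_zero.2 hvw)).ne' h0

/-- The Riesz representation in coordinates. It is what turns the Christoffel symbols of the first
kind into a vector. -/
theorem sum_smul_recip {g : Euc n →L[ℝ] Euc n →L[ℝ] ℝ} (hg : IsScalarProduct g) (l : Euc n →ₗ[ℝ] ℝ)
    (w : Euc n) : g (∑ i, l (stdBasis n i) • recip g i) w = l w := by
  have : (g (∑ i, l (stdBasis n i) • recip g i) : Euc n →ₗ[ℝ] ℝ) = l := by
    refine (stdBasis n).ext fun j => ?_
    simp [map_sum, apply_recip_stdBasis hg]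
  exact congrArg (fun f => f w) this

theorem eq_sum_smul_recip {g : Euc n →L[ℝ] Euc n →L[ℝ] ℝ} (hg : IsScalarProduct g) (v : Euc n) :
    v = ∑ i, g v (stdBasis n i) • recip g i :=
  eq_of_forall_apply_eq hg fun w => (sum_smul_recip hg (g v : Euc n →ₗ[ℝ] ℝ) w).symm

theorem eq_sum_smul_stdBasis {g : Euc n →L[ℝ] Euc n →L[ℝ] ℝ} (hg : IsScalarProduct g) (v : Euc n) :
    v = ∑ i, g v (recip g i) • stdBasis n i := by
  conv_lhs => rw [← (stdBasis n).sum_repr v]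
  refine Finset.sum_congr rfl fun i _ => ?_
  congr 1
  have : (g (recip g i) : Euc n →ₗ[ℝ] ℝ) = (stdBasis n).coord i := by
    refine (stdBasis n).ext fun j => ?_
    simp [apply_recip_stdBasis hg, Finsupp.single_apply, eq_comm]
  rw [hg.symm]
  exact (congrArg (fun f => f v) this).symm

/-- The map that sends the standard basis to the reciprocal one has the transposed inverse Gram
matrix as its matrix. -/
theorem detForm_recip {g : Euc n →L[ℝ] Euc n →L[ℝ] ℝ} (s : Fin n → Fin n) :
    detForm n (fun i => recip g (s i)) = (gram g).det⁻¹ * detForm n (fun i => stdBasis n (s i)) := by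
  have h := detForm_comp ((stdBasis n).constr ℝ (recip g)) (fun i => stdBasis n (s i))
  simp only [Module.Basis.constr_basis] at h
  rw [h, ← LinearMap.det_toMatrix (stdBasis n)]
  congr 1
  have : LinearMap.toMatrix (stdBasis n) (stdBasis n) ((stdBasis n).constr ℝ (recip g)) =
      (gram g)⁻¹ᵀ := by
    ext i j
    simp [LinearMap.toMatrix_apply, recip, Finsupp.single_apply, Finsupp.finsetSum_apply]
  rw [this, Matrix.det_transpose, Matrix.det_nonsing_inv, Ring.inverse_eq_inv']

/-- The permutation symbol. -/
def permSymbol (a : Fin (m + 1)) (f : Fin m → Fin (m + 1)) : ℝ :=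
  detForm (m + 1) (fun i => stdBasis (m + 1) ((Fin.cons a f : Fin (m + 1) → Fin (m + 1)) i))

theorem permSymbol_eq_zero {a : Fin (m + 1)} {f : Fin m → Fin (m + 1)}
    (h : ¬ Injective (Fin.cons a f : Fin (m + 1) → Fin (m + 1))) : permSymbol a f = 0 := by
  refine AlternatingMap.map_eq_zero_of_not_injective (stdBasis (m + 1)).det _ fun h' => h ?_
  exact Injective.of_comp h'

theorem permSymbol_mul_self {a : Fin (m + 1)} {f : Fin m → Fin (m + 1)}
    (h : Injective (Fin.cons a f : Fin (m + 1) → Fin (m + 1))) :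
    permSymbol a f * permSymbol a f = 1 := by
  let σ : Equiv.Perm (Fin (m + 1)) := Equiv.ofBijective _ (Finite.injective_iff_bijective.1 h)
  have : permSymbol a f = ((Equiv.Perm.sign σ : ℤ) : ℝ) := by
    have := AlternatingMap.map_perm (stdBasis (m + 1)).det (stdBasis (m + 1)) σ
    rw [Module.Basis.det_self] at this
    refine Eq.trans ?_ (this.trans ?_)
    · rfl
    · simp [Units.smul_def]
  rw [this]
  rcases Int.units_eq_one_or (Equiv.Perm.sign σ) with h | h <;> simp [h]

/-- Exactly m! choices of `f` complete `a` to a permutation, and each contributes (±1)² = 1. If `a ≠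
c`, no `f` completes both. -/
theorem sum_permSymbol (a c : Fin (m + 1)) :
    ∑ f : Fin m → Fin (m + 1), permSymbol a f * permSymbol c f =
      if a = c then (m.factorial : ℝ) else 0 := by
  classical
  split_ifs with hac
  · subst hac
    have h1 : ∀ f : Fin m → Fin (m + 1), permSymbol a f * permSymbol a f =
        if Injective (Fin.cons a f : Fin (m + 1) → Fin (m + 1)) then (1 : ℝ) else 0 := by
      intro f
      split_ifs with h
      · exact permSymbol_mul_self h
      · rw [permSymbol_eq_zero h, zero_mul]
    simp only [h1, Finset.sum_boole]
    norm_cast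
    have e : {f : Fin m → Fin (m + 1) // Injective (Fin.cons a f : Fin (m + 1) → Fin (m + 1))} ≃
        (Fin m ↪ {x : Fin (m + 1) // x ≠ a}) :=
      { toFun := fun f => ⟨fun i => ⟨f.1 i, fun h => (Fin.cons_injective_iff.1 f.2).1 ⟨i, h⟩⟩,
          fun i j h => (Fin.cons_injective_iff.1 f.2).2 (congrArg Subtype.val h)⟩
        invFun := fun f => ⟨fun i => (f i).1, Fin.cons_injective_iff.2
          ⟨fun ⟨i, h⟩ => (f i).2 h, Subtype.val_injective.comp f.injective⟩⟩
        left_inv := fun f => rfl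
        right_inv := fun f => rfl }
    rw [← Fintype.card_subtype, Fintype.card_congr e, Fintype.card_embedding_eq]
    simp [Nat.descFactorial_self]
  · refine Finset.sum_eq_zero fun f _ => ?_
    by_cases h1 : Injective (Fin.cons a f : Fin (m + 1) → Fin (m + 1))
    · by_cases h2 : Injective (Fin.cons c f : Fin (m + 1) → Fin (m + 1))
      · exfalso
        -- The completed list is surjective, so it contains `c`. As `c ≠ a`, the entry `c` lies in
        -- `f`, which contradicts `h2`.
        obtain ⟨i, hi⟩ := (Finite.injective_iff_surjective.1 h1) c
        refine Fin.cases (fun h => hac ?_) (fun j h => ?_) i hi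
        · simpa using h
        · exact (Fin.cons_injective_iff.1 h2).1 ⟨j, by simpa using h⟩
      · rw [permSymbol_eq_zero h2, mul_zero]
    · rw [permSymbol_eq_zero h1, zero_mul]

end LinearAlgebra

/-! ### Contraction of the volume form as an isometry and an isomorphism. -/

section LinearAlgebra

variable {n m : ℕ} {g : Euc (m + 1) →L[ℝ] Euc (m + 1) →L[ℝ] ℝ}

theorem detForm_curryLeft_recip (hg : IsScalarProduct g) (X : Euc (m + 1))
    (f : Fin m → Fin (m + 1)) :
    (detForm (m + 1)).curryLeft X (fun i => recip g (f i)) =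
      (gram g).det⁻¹ * ∑ a, g X (stdBasis (m + 1) a) * permSymbol a f := by
  conv_lhs => rw [eq_sum_smul_recip hg X]
  rw [map_sum, ContinuousAlternatingMap.sum_apply, Finset.mul_sum]
  refine Finset.sum_congr rfl fun a _ => ?_
  rw [map_smul, ContinuousAlternatingMap.smul_apply, smul_eq_mul, mul_left_comm]
  congr 1
  have := detForm_recip (g := g) (Fin.cons a f)
  rw [permSymbol, ← this, ContinuousAlternatingMap.curryLeft_apply_apply]
  congr 1
  funext i
  refine Fin.cases ?_ (fun j => ?_) i <;> simp [Matrix.vecCons]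

theorem detForm_curryLeft_stdBasis_self (a : Fin (m + 1)) (f : Fin m → Fin (m + 1)) :
    (detForm (m + 1)).curryLeft (stdBasis (m + 1) a) (fun i => stdBasis (m + 1) (f i)) =
      permSymbol a f := by
  rw [permSymbol, ContinuousAlternatingMap.curryLeft_apply_apply]
  congr 1
  funext i
  refine Fin.cases ?_ (fun j => ?_) i <;> simp [Matrix.vecCons]

theorem detForm_curryLeft_stdBasis (hg : IsScalarProduct g) (X : Euc (m + 1))
    (f : Fin m → Fin (m + 1)) :
    (detForm (m + 1)).curryLeft X (fun i => stdBasis (m + 1) (f i)) =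
      ∑ a, g X (recip g a) * permSymbol a f := by
  conv_lhs => rw [eq_sum_smul_stdBasis hg X]
  rw [map_sum, ContinuousAlternatingMap.sum_apply]
  refine Finset.sum_congr rfl fun a _ => ?_
  rw [map_smul, ContinuousAlternatingMap.smul_apply, smul_eq_mul,
    detForm_curryLeft_stdBasis_self]

/-- Expanding `X` in the reciprocal basis and `Y` in the standard one leaves a sum of products of
permutation symbols, which `sum_permSymbol` collapses to the diagonal. The inverse determinant comes
from the raised indices, by `detForm_recip`. -/
theorem sum_detForm_curryLeft (hg : IsScalarProduct g) (X Y : Euc (m + 1)) :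
    (m.factorial : ℝ)⁻¹ * ∑ f : Fin m → Fin (m + 1),
      (detForm (m + 1)).curryLeft X (fun i => recip g (f i)) *
        (detForm (m + 1)).curryLeft Y (fun i => stdBasis (m + 1) (f i)) =
      (gram g).det⁻¹ * g X Y := by
  have hY : g X Y = ∑ a, g X (stdBasis (m + 1) a) * g Y (recip g a) := by
    conv_lhs => rw [eq_sum_smul_stdBasis hg Y]
    simp [map_sum, mul_comm]
  simp only [detForm_curryLeft_recip hg, detForm_curryLeft_stdBasis hg]
  have h : ∀ f : Fin m → Fin (m + 1),
      ((gram g).det⁻¹ * ∑ a, g X (stdBasis (m + 1) a) * permSymbol a f) *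
        (∑ c, g Y (recip g c) * permSymbol c f) =
      ∑ a, ∑ c, (gram g).det⁻¹ * (g X (stdBasis (m + 1) a) * g Y (recip g c)) *
        (permSymbol a f * permSymbol c f) := by
    intro f
    rw [mul_assoc, Finset.sum_mul_sum, Finset.mul_sum]
    refine Finset.sum_congr rfl fun a _ => ?_
    rw [Finset.mul_sum]
    exact Finset.sum_congr rfl fun c _ => by ring
  simp only [h]
  rw [Finset.sum_comm]
  have h2 : ∀ a : Fin (m + 1), ∑ f : Fin m → Fin (m + 1), ∑ c,
      (gram g).det⁻¹ * (g X (stdBasis (m + 1) a) * g Y (recip g c)) *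
        (permSymbol a f * permSymbol c f) =
      (gram g).det⁻¹ * (g X (stdBasis (m + 1) a) * g Y (recip g a)) * (m.factorial : ℝ) := by
    intro a
    rw [Finset.sum_comm]
    simp only [← Finset.mul_sum, sum_permSymbol]
    simp
  simp only [h2]
  rw [← Finset.sum_mul, ← Finset.mul_sum, ← hY]
  have : (m.factorial : ℝ) ≠ 0 := by positivity
  field_simp

theorem sq_coeff_volForm (hg : IsScalarProduct g)
    (o : Orientation ℝ (Euc (m + 1)) (Fin (m + 1))) :
    (orientSign o * Real.sqrt (gram g).det) * (orientSign o * Real.sqrt (gram g).det) =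
      (gram g).det := by
  rw [mul_mul_mul_comm, orientSign_mul_self, Real.mul_self_sqrt (det_gram_pos hg).le, one_mul]

theorem coeff_volForm_ne_zero (hg : IsScalarProduct g)
    (o : Orientation ℝ (Euc (m + 1)) (Fin (m + 1))) :
    orientSign o * Real.sqrt (gram g).det ≠ 0 := fun h => by
  have := sq_coeff_volForm hg o
  rw [h, zero_mul] at this
  exact (det_gram_pos hg).ne this

/-- The scalar product of the `m`-forms `ι_X μ` and `ι_Y μ` is that of `X` and `Y`. -/
theorem sum_volForm_curryLeft (hg : IsScalarProduct g)
    (o : Orientation ℝ (Euc (m + 1)) (Fin (m + 1))) (X Y : Euc (m + 1)) :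
    (m.factorial : ℝ)⁻¹ * ∑ f : Fin m → Fin (m + 1),
      (volForm g o).curryLeft X (fun i => recip g (f i)) *
        (volForm g o).curryLeft Y (fun i => stdBasis (m + 1) (f i)) = g X Y := by
  have h := sum_detForm_curryLeft hg X Y
  have h0 := (det_gram_pos hg).ne'
  calc _ = (gram g).det * ((m.factorial : ℝ)⁻¹ * ∑ f : Fin m → Fin (m + 1),
      (detForm (m + 1)).curryLeft X (fun i => recip g (f i)) *
        (detForm (m + 1)).curryLeft Y (fun i => stdBasis (m + 1) (f i))) := by
        rw [← sq_coeff_volForm hg o, mul_left_comm]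
        refine congrArg _ ?_
        rw [Finset.mul_sum]
        refine Finset.sum_congr rfl fun f _ => ?_
        rw [volForm_eq, ContinuousAlternatingMap.curryLeft_smul]
        exact mul_mul_mul_comm _ _ _ _
    _ = _ := by rw [h]; field_simp

theorem formNormSq_curryLeft_volForm (hg : IsScalarProduct g)
    (o : Orientation ℝ (Euc (m + 1)) (Fin (m + 1))) (X : Euc (m + 1)) :
    formNormSq g ((volForm g o).curryLeft X) = g X X :=
  sum_volForm_curryLeft hg o X X

/-- The scalar product `g` with the standard inner product of `ℝⁿ`. -/
theorem isScalarProduct_innerSL : IsScalarProduct (innerSL ℝ : Euc n →L[ℝ] Euc n →L[ℝ] ℝ) where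
  symm v w := (real_inner_comm w v : inner ℝ v w = inner ℝ w v)
  pos v hv := (real_inner_self_pos.2 hv : 0 < inner ℝ v v)

/-- For the Euclidean product, the square norm of ι_X det is a positive multiple of that of `X`. -/
theorem detForm_curryLeft_injective : Injective (detForm (m + 1)).curryLeft := by
  rw [injective_iff_map_eq_zero]
  intro X hX
  have h := sum_detForm_curryLeft isScalarProduct_innerSL X X
  rw [hX] at h
  by_contra h0
  have h1 := (isScalarProduct_innerSL (n := m + 1)).pos X h0
  have h2 := det_gram_pos (isScalarProduct_innerSL (n := m + 1))
  have := mul_pos (inv_pos.2 h2) h1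
  rw [← h] at this
  simp at this

/-- A dimension count: m-forms on a space of dimension m + 1 have dimension C(m + 1, m) = m + 1, so
the injective map is onto. Continuous forms embed in algebraic ones, which gives the upper bound. -/
theorem detForm_curryLeft_surjective : Surjective (detForm (m + 1)).curryLeft := by
  let e := exteriorPower.alternatingMapLinearEquiv (R := ℝ) (M := Euc (m + 1)) (N := ℝ) (n := m)
  have : Module.Finite ℝ (Euc (m + 1) [⋀^Fin m]→ₗ[ℝ] ℝ) := Module.Finite.equiv e.symm
  have h1 : Module.finrank ℝ (Euc (m + 1) [⋀^Fin m]→ₗ[ℝ] ℝ) = m + 1 := by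
    refine e.finrank_eq.trans ((Subspace.dual_finrank_eq (K := ℝ)
      (V := ⋀[ℝ]^m (Euc (m + 1)))).trans ?_)
    rw [exteriorPower.finrank_eq]
    simp
  let ι : (Euc (m + 1) [⋀^Fin m]→L[ℝ] ℝ) →ₗ[ℝ] (Euc (m + 1) [⋀^Fin m]→ₗ[ℝ] ℝ) :=
    ContinuousAlternatingMap.toAlternatingMapLinear
  have hι : Injective ι := ContinuousAlternatingMap.toAlternatingMap_injective
  have : Module.Finite ℝ (Euc (m + 1) [⋀^Fin m]→L[ℝ] ℝ) := Module.Finite.of_injective ι hι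
  have h2 := LinearMap.finrank_le_finrank_of_injective hι
  have hinj : Injective ((detForm (m + 1)).curryLeft :
      Euc (m + 1) →ₗ[ℝ] (Euc (m + 1) [⋀^Fin m]→L[ℝ] ℝ)) :=
    detForm_curryLeft_injective
  have h3 := LinearMap.finrank_le_finrank_of_injective hinj
  have h4 : Module.finrank ℝ (Euc (m + 1)) = m + 1 := by simp
  exact (LinearMap.injective_iff_surjective_of_finrank_eq_finrank (by omega)).1 hinj

/-- The isomorphism `X ↦ ι_X det` of vectors with `m`-forms. -/
def detEquiv (m : ℕ) : Euc (m + 1) ≃L[ℝ] (Euc (m + 1) [⋀^Fin m]→L[ℝ] ℝ) :=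
  ContinuousLinearEquiv.ofBijective (detForm (m + 1)).curryLeft
    (LinearMap.ker_eq_bot.2 detForm_curryLeft_injective)
    (LinearMap.range_eq_top.2 detForm_curryLeft_surjective)

theorem detEquiv_apply (X : Euc (m + 1)) : detEquiv m X = (detForm (m + 1)).curryLeft X := rfl

theorem volForm_curryLeft (o : Orientation ℝ (Euc (m + 1)) (Fin (m + 1))) (X : Euc (m + 1)) :
    (volForm g o).curryLeft X = (orientSign o * Real.sqrt (gram g).det) • detEquiv m X := by
  rw [volForm_eq, ContinuousAlternatingMap.curryLeft_smul]; rfl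

theorem volForm_curryLeft_injective (hg : IsScalarProduct g)
    (o : Orientation ℝ (Euc (m + 1)) (Fin (m + 1))) :
    Injective fun X => (volForm g o).curryLeft X := by
  intro X Y h
  simp only [volForm_curryLeft] at h
  exact (detEquiv m).injective (smul_right_injective _ (coeff_volForm_ne_zero hg o) h)

theorem volForm_curryLeft_surjective (hg : IsScalarProduct g)
    (o : Orientation ℝ (Euc (m + 1)) (Fin (m + 1))) :
    Surjective fun X => (volForm g o).curryLeft X := fun β =>
  ⟨(orientSign o * Real.sqrt (gram g).det)⁻¹ • (detEquiv m).symm β, by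
    simp only [volForm_curryLeft, map_smul, ContinuousLinearEquiv.apply_symm_apply]
    rw [smul_smul, inv_mul_cancel₀ (coeff_volForm_ne_zero hg o), one_smul]⟩

/-- Surjectivity makes the `invFun` in `assocVector` a genuine preimage instead of a default value.
-/
theorem volForm_curryLeft_assocVector (hg : IsScalarProduct g)
    (o : Orientation ℝ (Euc (m + 1)) (Fin (m + 1))) (β : Euc (m + 1) [⋀^Fin m]→L[ℝ] ℝ) :
    (volForm g o).curryLeft (assocVector g o β) = β :=
  Function.invFun_eq (volForm_curryLeft_surjective hg o β)

theorem assocVector_eq_iff (hg : IsScalarProduct g)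
    (o : Orientation ℝ (Euc (m + 1)) (Fin (m + 1))) (β : Euc (m + 1) [⋀^Fin m]→L[ℝ] ℝ)
    (X : Euc (m + 1)) : assocVector g o β = X ↔ (volForm g o).curryLeft X = β := by
  constructor
  · rintro rfl
    exact volForm_curryLeft_assocVector hg o β
  · intro h
    exact volForm_curryLeft_injective hg o ((volForm_curryLeft_assocVector hg o β).trans h.symm)

/-- The metric enters only through the scalar √det; the conformal scaling of `B` is read off from
this. -/
theorem assocVector_eq (hg : IsScalarProduct g)
    (o : Orientation ℝ (Euc (m + 1)) (Fin (m + 1))) (β : Euc (m + 1) [⋀^Fin m]→L[ℝ] ℝ) :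
    assocVector g o β = (orientSign o * Real.sqrt (gram g).det)⁻¹ • (detEquiv m).symm β := by
  rw [assocVector_eq_iff hg, volForm_curryLeft, map_smul, ContinuousLinearEquiv.apply_symm_apply,
    smul_smul, mul_inv_cancel₀ (coeff_volForm_ne_zero hg o), one_smul]

theorem formNormSq_eq (hg : IsScalarProduct g)
    (o : Orientation ℝ (Euc (m + 1)) (Fin (m + 1))) (β : Euc (m + 1) [⋀^Fin m]→L[ℝ] ℝ) :
    formNormSq g β = g (assocVector g o β) (assocVector g o β) := by
  conv_lhs => rw [← volForm_curryLeft_assocVector hg o β]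
  exact formNormSq_curryLeft_volForm hg o _

end LinearAlgebra

/-! ### The Hodge star, musical isomorphisms and conformal change. -/

section LinearAlgebra

variable {n m : ℕ}

theorem contract_apply {l : ℕ} (k : ℕ) (u : Fin k → Euc n) (α : Euc n [⋀^Fin (l + k)]→L[ℝ] ℝ)
    (w : Fin l → Euc n) :
    contract k u α w = α fun i => if h : i.1 < k then u ⟨i.1, h⟩ else w ⟨i.1 - k, by omega⟩ := by
  induction k with
  | zero => simp [contract]
  | succ k ih =>
    rw [contract, ih, ContinuousAlternatingMap.curryLeft_apply_apply]
    congr 1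
    funext i
    refine Fin.cases (n := l + k) ?_ (fun j => ?_) i
    · simp [Matrix.vecCons]
    · simp [Matrix.vecCons, Fin.tail]

/-- Moving the remaining argument from the last slot to the first is a cyclic rotation of m + 1
entries, of sign (-1)ᵐ. -/
theorem contract_castForm_apply (u : Fin m → Euc n) (μ : Euc n [⋀^Fin (m + 1)]→L[ℝ] ℝ)
    (w : Fin 1 → Euc n) :
    contract m u (castForm (Nat.add_comm m 1) μ) w = (-1) ^ m * μ.curryLeft (w 0) u := by
  rw [contract_apply, ContinuousAlternatingMap.curryLeft_apply_apply]
  have h1 := AlternatingMap.map_perm μ.toAlternatingMap (Matrix.vecCons (w 0) u)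
    (finRotate (m + 1))
  rw [sign_finRotate] at h1
  have h2 : μ (Fin.snoc u (w 0) : Fin (m + 1) → Euc n) =
      (-1) ^ m * μ (Matrix.vecCons (w 0) u) := by
    rw [Fin.snoc_eq_cons_rotate]
    refine h1.trans ?_
    rw [Units.smul_def]
    simp
  rw [← h2]
  refine congrArg (fun v => μ v) (funext fun i => ?_)
  change (if h : i.1 < m then u ⟨i.1, h⟩ else w ⟨i.1 - m, _⟩) = _
  by_cases h : i.1 < m
  · simp [Fin.snoc, h, Fin.castLT]
  · rw [dif_neg h]
    simpa [Fin.snoc, h] using congrArg w (Subsingleton.elim _ _)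

/-- The `1`-form `g(X, ·)`. -/
def flatForm (g : Euc n →L[ℝ] Euc n →L[ℝ] ℝ) (X : Euc n) : Euc n [⋀^Fin 1]→L[ℝ] ℝ :=
  ContinuousAlternatingMap.ofSubsingleton ℝ (Euc n) ℝ (0 : Fin 1) (g X)

theorem flatForm_apply (g : Euc n →L[ℝ] Euc n →L[ℝ] ℝ) (X : Euc n) (w : Fin 1 → Euc n) :
    flatForm g X w = g X (w 0) := rfl

/-- With β = ι_B μ, the coordinate formula evaluated on `w` is, up to the rotation sign, the scalar
product of ι_B μ and ι_w μ, and that is g(B, w). -/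
theorem starForm_eq {g : Euc (m + 1) →L[ℝ] Euc (m + 1) →L[ℝ] ℝ} (hg : IsScalarProduct g)
    (o : Orientation ℝ (Euc (m + 1)) (Fin (m + 1))) (β : Euc (m + 1) [⋀^Fin m]→L[ℝ] ℝ) :
    starForm (Nat.add_comm m 1) g o β = (-1 : ℝ) ^ m • flatForm g (assocVector g o β) := by
  ext w
  have h : ∀ w, starForm (Nat.add_comm m 1) g o β w = (m.factorial : ℝ)⁻¹ *
      ∑ f : Fin m → Fin (m + 1), β (fun a => recip g (f a)) *
        contract m (fun a => stdBasis (m + 1) (f a))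
          (castForm (Nat.add_comm m 1) (volForm g o)) w := by
    intro w
    rw [starForm, ContinuousAlternatingMap.smul_apply, ContinuousAlternatingMap.sum_apply]
    rfl
  rw [h, ContinuousAlternatingMap.smul_apply, flatForm_apply, smul_eq_mul,
    ← sum_volForm_curryLeft hg o, volForm_curryLeft_assocVector hg, mul_left_comm]
  refine congrArg _ ?_
  rw [Finset.mul_sum]
  refine Finset.sum_congr rfl fun f _ => ?_
  rw [contract_castForm_apply, mul_left_comm]

theorem exists_flatForm_eq {g : Euc n →L[ℝ] Euc n →L[ℝ] ℝ} (hg : IsScalarProduct g)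
    (θ : Euc n [⋀^Fin 1]→L[ℝ] ℝ) : ∃ X, flatForm g X = θ := by
  let l := (ContinuousAlternatingMap.ofSubsingleton ℝ (Euc n) ℝ (0 : Fin 1)).symm θ
  refine ⟨∑ i, l (stdBasis n i) • recip g i, ?_⟩
  have : g (∑ i, l (stdBasis n i) • recip g i) = l := by
    ext w
    exact sum_smul_recip hg (l : Euc n →ₗ[ℝ] ℝ) w
  rw [flatForm, this]
  exact Equiv.apply_symm_apply _ _

theorem flatForm_injective {g : Euc n →L[ℝ] Euc n →L[ℝ] ℝ} (hg : IsScalarProduct g) :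
    Injective (flatForm g) := fun _ _ h =>
  eq_of_forall_apply_eq hg fun u => congrArg (fun θ => θ fun _ => u) h

theorem flatForm_smul_smul (g : Euc n →L[ℝ] Euc n →L[ℝ] ℝ) (c d : ℝ) (X : Euc n) :
    flatForm (c • g) (d • X) = (c * d) • flatForm g X := by
  ext w
  simp [flatForm_apply, mul_assoc, mul_left_comm]

/-- Here a single vector enters the first slot of μ, so no sign appears. -/
theorem starForm_flatForm {g : Euc (m + 1) →L[ℝ] Euc (m + 1) →L[ℝ] ℝ} (hg : IsScalarProduct g)
    (o : Orientation ℝ (Euc (m + 1)) (Fin (m + 1))) (X : Euc (m + 1)) :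
    starForm rfl g o (flatForm g X) = (volForm g o).curryLeft X := by
  have h : starForm rfl g o (flatForm g X) = ((1 : ℕ).factorial : ℝ)⁻¹ •
      ∑ f : Fin 1 → Fin (m + 1), g X (recip g (f 0)) •
        (volForm g o).curryLeft (stdBasis (m + 1) (f 0)) := rfl
  rw [h]
  conv_rhs => rw [eq_sum_smul_stdBasis hg X]
  rw [map_sum, Nat.factorial_one, Nat.cast_one, inv_one, one_smul]
  refine Fintype.sum_equiv (Equiv.funUnique (Fin 1) (Fin (m + 1))) _ _ fun f => ?_
  rw [map_smul]
  rfl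

theorem formNormSq_flatForm {g : Euc n →L[ℝ] Euc n →L[ℝ] ℝ} (hg : IsScalarProduct g)
    (X : Euc n) : formNormSq g (flatForm g X) = g X X := by
  have h : formNormSq g (flatForm g X) = ((1 : ℕ).factorial : ℝ)⁻¹ *
      ∑ f : Fin 1 → Fin n, g X (recip g (f 0)) * g X (stdBasis n (f 0)) := rfl
  rw [h, Nat.factorial_one, Nat.cast_one, inv_one, one_mul]
  conv_rhs => rw [eq_sum_smul_stdBasis hg X, hg.symm, map_sum]
  rw [← eq_sum_smul_stdBasis hg X]
  refine Fintype.sum_equiv (Equiv.funUnique (Fin 1) (Fin n)) _ _ fun f => ?_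
  rw [map_smul]
  rfl

theorem formNormSq_smul {k : ℕ} (g : Euc n →L[ℝ] Euc n →L[ℝ] ℝ) (c : ℝ)
    (α : Euc n [⋀^Fin k]→L[ℝ] ℝ) : formNormSq g (c • α) = c ^ 2 * formNormSq g α := by
  unfold formNormSq
  rw [mul_left_comm]
  refine congrArg _ ?_
  rw [Finset.mul_sum]
  refine Finset.sum_congr rfl fun f _ => ?_
  simp only [ContinuousAlternatingMap.smul_apply, smul_eq_mul]
  ring

theorem IsScalarProduct.smul {g : Euc n →L[ℝ] Euc n →L[ℝ] ℝ} (hg : IsScalarProduct g) {c : ℝ}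
    (hc : 0 < c) : IsScalarProduct (c • g) where
  symm v w := congrArg (c * ·) (hg.symm v w)
  pos v hv := mul_pos hc (hg.pos v hv)

/-- The factor by which the vector associated to an `m`-form changes when the scalar product of
`ℝᵐ⁺¹` is multiplied by `c`. -/
def volFactor (m : ℕ) (c : ℝ) : ℝ := (Real.sqrt (c ^ (m + 1)))⁻¹

theorem volFactor_pos {c : ℝ} (hc : 0 < c) : 0 < volFactor m c := by
  unfold volFactor; positivity

/-- The Gram matrix has size m + 1, so its determinant scales by `c ^ (m + 1)`. The volume form
scales by the square root of this, and `B` by the inverse. -/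
theorem assocVector_smul {g : Euc (m + 1) →L[ℝ] Euc (m + 1) →L[ℝ] ℝ} (hg : IsScalarProduct g)
    {c : ℝ} (hc : 0 < c) (o : Orientation ℝ (Euc (m + 1)) (Fin (m + 1)))
    (β : Euc (m + 1) [⋀^Fin m]→L[ℝ] ℝ) :
    assocVector (c • g) o β = volFactor m c • assocVector g o β := by
  have hdet : (gram (c • g)).det = c ^ (m + 1) * (gram g).det := by
    have : gram (c • g) = c • gram g := rfl
    rw [this, Matrix.det_smul, Fintype.card_fin]
  rw [assocVector_eq (hg.smul hc), assocVector_eq hg, hdet, Real.sqrt_mul (by positivity),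
    smul_smul, volFactor]
  congr 1
  rw [← mul_inv]
  congr 1
  ring

theorem formNormSq_pos {g : Euc (m + 1) →L[ℝ] Euc (m + 1) →L[ℝ] ℝ} (hg : IsScalarProduct g)
    (o : Orientation ℝ (Euc (m + 1)) (Fin (m + 1))) {β : Euc (m + 1) [⋀^Fin m]→L[ℝ] ℝ}
    (hβ : β ≠ 0) : 0 < formNormSq g β := by
  rw [formNormSq_eq hg o]
  refine hg.pos _ fun h => hβ ?_
  rw [← volForm_curryLeft_assocVector hg o β, h, map_zero]

/-- For the scalar product `ḡ = |β|² g`, the form `⋆β` of `g` is the only normalization of the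
form `⋆β` of `ḡ`. -/
theorem isNormalization_iff {g : Euc (m + 1) →L[ℝ] Euc (m + 1) →L[ℝ] ℝ} (hg : IsScalarProduct g)
    (o : Orientation ℝ (Euc (m + 1)) (Fin (m + 1))) {β : Euc (m + 1) [⋀^Fin m]→L[ℝ] ℝ}
    (hβ : β ≠ 0) (ξ : Euc (m + 1) [⋀^Fin 1]→L[ℝ] ℝ) :
    (formNorm (formNormSq g β • g) (starForm (Nat.add_comm m 1) (formNormSq g β • g) o β) • ξ =
        starForm (Nat.add_comm m 1) (formNormSq g β • g) o β ∧
      formNorm (formNormSq g β • g) ξ ≤ 1) ↔ ξ = starForm (Nat.add_comm m 1) g o β := by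
  have hN := formNormSq_pos hg o hβ
  have hNeq := formNormSq_eq hg o β
  set N := formNormSq g β
  set B := assocVector g o β
  have hl : 0 < volFactor m N := volFactor_pos hN
  set l := volFactor m N
  have h1 : starForm (Nat.add_comm m 1) (N • g) o β =
      (N * l) • starForm (Nat.add_comm m 1) g o β := by
    rw [starForm_eq (hg.smul hN), starForm_eq hg, assocVector_smul hg hN, flatForm_smul_smul,
      smul_comm]
  have h2 : formNormSq (N • g) (starForm (Nat.add_comm m 1) g o β) = 1 := by
    -- Raising the index with N g instead of g divides the vector by N. The square norm is therefore
    -- N · N⁻² · g(B, B) = 1.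
    have h3 : flatForm g B = flatForm (N • g) (N⁻¹ • B) := by
      rw [flatForm_smul_smul, mul_inv_cancel₀ hN.ne', one_smul]
    rw [starForm_eq hg, formNormSq_smul, h3, formNormSq_flatForm (hg.smul hN)]
    have : (N • g) (N⁻¹ • B) (N⁻¹ • B) = N * (N⁻¹ * (N⁻¹ * g B B)) := by
      simp [mul_left_comm]
    rw [this, ← hNeq, ← pow_mul, mul_comm m 2, pow_mul]
    field_simp
    simp
  have h3 : formNorm (N • g) (starForm (Nat.add_comm m 1) (N • g) o β) = N * l := by
    rw [formNorm, h1, formNormSq_smul, h2, mul_one, Real.sqrt_sq (by positivity)]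
  rw [h3, h1]
  constructor
  · rintro ⟨h, -⟩
    exact smul_right_injective _ (mul_pos hN hl).ne' h
  · rintro rfl
    exact ⟨rfl, by rw [formNorm, h2, Real.sqrt_one]⟩

/-- `β = ⋆θ` if and only if `⋆β = (-1)ᵐ θ`. -/
theorem eq_starForm_iff {g : Euc (m + 1) →L[ℝ] Euc (m + 1) →L[ℝ] ℝ} (hg : IsScalarProduct g)
    (o : Orientation ℝ (Euc (m + 1)) (Fin (m + 1))) (β : Euc (m + 1) [⋀^Fin m]→L[ℝ] ℝ)
    (θ : Euc (m + 1) [⋀^Fin 1]→L[ℝ] ℝ) :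
    β = starForm rfl g o θ ↔ (-1 : ℝ) ^ m • θ = starForm (Nat.add_comm m 1) g o β := by
  obtain ⟨X, rfl⟩ := exists_flatForm_eq hg θ
  rw [starForm_flatForm hg, starForm_eq hg, eq_comm, ← assocVector_eq_iff hg o β X]
  constructor
  · rintro rfl; rfl
  · intro h
    exact (flatForm_injective hg (smul_right_injective _ (by positivity : (-1 : ℝ) ^ m ≠ 0) h)).symm

end LinearAlgebra

/-! ### Exterior derivative and Levi-Civita derivative in coordinates. -/

section Calculus

variable {n : ℕ} {S : Set (Euc n)} {z : Euc n}

/-- `ofSubsingleton` as a continuous linear map from covectors to `1`-forms. -/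
def covectorForm (n : ℕ) : (Euc n →L[ℝ] ℝ) →L[ℝ] (Euc n [⋀^Fin 1]→L[ℝ] ℝ) :=
  LinearMap.toContinuousLinearMap
    { toFun := ContinuousAlternatingMap.ofSubsingleton ℝ (Euc n) ℝ (0 : Fin 1)
      map_add' := fun _ _ => rfl
      map_smul' := fun _ _ => rfl }

theorem extDerivWithin_flatForm {h : Euc n → Euc n →L[ℝ] Euc n →L[ℝ] ℝ} {b : Euc n → Euc n}
    {h' : Euc n →L[ℝ] Euc n →L[ℝ] Euc n →L[ℝ] ℝ} {b' : Euc n →L[ℝ] Euc n}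
    (hS : UniqueDiffWithinAt ℝ S z) (hh : HasFDerivWithinAt h h' S z)
    (hb : HasFDerivWithinAt b b' S z) (w : Fin 2 → Euc n) :
    extDerivWithin (fun y => flatForm (h y) (b y)) S z w =
      (h' (w 0) (b z) (w 1) + h z (b' (w 0)) (w 1)) -
        (h' (w 1) (b z) (w 0) + h z (b' (w 1)) (w 0)) := by
  have hd : DifferentiableWithinAt ℝ (fun y => flatForm (h y) (b y)) S z :=
    (covectorForm n).differentiableAt.comp_differentiableWithinAt z
      (hh.clm_apply hb).differentiableWithinAt
  have hv : ∀ u v, fderivWithin ℝ (fun y => h y (b y) v) S z u =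
      h' u (b z) v + h z (b' u) v := by
    intro u v
    rw [((hh.clm_apply hb).clm_apply (hasFDerivWithinAt_const v z S)).fderivWithin hS]
    simp [add_comm]
  rw [extDerivWithin_apply hd hS, Fin.sum_univ_two]
  have h0 : (fun y => flatForm (h y) (b y) ((0 : Fin 2).removeNth w)) =
      fun y => h y (b y) (w 1) := rfl
  have h1 : (fun y => flatForm (h y) (b y) ((1 : Fin 2).removeNth w)) =
      fun y => h y (b y) (w 0) := rfl
  rw [h0, h1, hv, hv]
  simp
  ring

theorem hasFDerivWithinAt_smul {E V : Type*} [NormedAddCommGroup E] [NormedSpace ℝ E]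
    [NormedAddCommGroup V] [NormedSpace ℝ V] {s : Set E} {x : E} {c : E → ℝ} {f : E → V}
    {c' : E →L[ℝ] ℝ} {f' : E →L[ℝ] V} (hc : HasFDerivWithinAt c c' s x)
    (hf : HasFDerivWithinAt f f' s x) :
    HasFDerivWithinAt (fun y => c y • f y) (c x • f' + c'.smulRight (f x)) s x :=
  hc.smul hf

set_option synthInstance.maxHeartbeats 400000 in
/-- Let `ḡ = |b|² h` and let `X = l b`. With `F = |b|² l`, the vector `∇_X X` of `ḡ` differs from
`(dF(X) / F) X` by the vector dual to `l² ι_b d(h(b, ·))`. -/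
theorem conformal_leviCivita {h : Euc n → Euc n →L[ℝ] Euc n →L[ℝ] ℝ} {b : Euc n → Euc n}
    {l : Euc n → ℝ} (hS : UniqueDiffWithinAt ℝ S z)
    (dh : DifferentiableWithinAt ℝ h S z) (db : DifferentiableWithinAt ℝ b S z)
    (dl : DifferentiableWithinAt ℝ l S z)
    (hp : IsScalarProduct (h z)) (hbz : b z ≠ 0)
    {G : Euc n → Euc n →L[ℝ] Euc n →L[ℝ] ℝ} {X : Euc n → Euc n} {F : Euc n → ℝ}
    (hG : ∀ y, G y = h y (b y) (b y) • h y) (hX : ∀ y, X y = l y • b y)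
    (hF : ∀ y, F y = h y (b y) (b y) * l y) (v : Euc n) :
    h z (fderivWithin ℝ X S z (X z) + ∑ k, ((1 / 2 : ℝ) *
        (fderivWithin ℝ G S z (X z) (X z) (stdBasis n k) +
          fderivWithin ℝ G S z (X z) (X z) (stdBasis n k) -
          fderivWithin ℝ G S z (stdBasis n k) (X z) (X z))) • recip (G z) k) v =
      l z ^ 2 * extDerivWithin (fun y => flatForm (h y) (b y)) S z ![b z, v] +
        fderivWithin ℝ F S z (b z) / h z (b z) (b z) * (l z * h z (b z) v) := by
  obtain ⟨h', hh'⟩ := dh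
  obtain ⟨b', hb'⟩ := db
  obtain ⟨l', hl'⟩ := dl
  have hNpos := hp.pos _ hbz
  have hN' := (hh'.clm_apply hb').clm_apply hb'
  have hG' := hasFDerivWithinAt_smul (V := Euc n →L[ℝ] Euc n →L[ℝ] ℝ) hN' hh'
  rw [show (fun y => h y (b y) (b y) • h y) = G from (funext hG).symm] at hG'
  have hX' := hl'.smul hb'
  rw [show l • b = X from (funext hX).symm] at hX'
  have hF' := hN'.mul hl'
  rw [show (fun y => h y (b y) (b y)) * l = F from (funext hF).symm] at hF'
  have hGz : IsScalarProduct (G z) := by rw [hG]; exact hp.smul hNpos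
  set D := fderivWithin ℝ G S z with hD
  -- The Christoffel symbol is linear in its last slot, so `sum_smul_recip` applies to it. That
  -- lemma pairs with `G z`, which explains the factor h(b, b) in `hΓ`.
  let Γ : Euc n →ₗ[ℝ] ℝ :=
    { toFun := fun w => (1 / 2 : ℝ) * (D (X z) (X z) w + D (X z) (X z) w - D w (X z) (X z))
      map_add' := fun u w => by simp only [map_add, add_apply]; ring
      map_smul' := fun c w => by
        simp only [map_smul, smul_apply, smul_eq_mul, RingHom.id_apply]; ring }
  have hΓ : h z (b z) (b z) * h z (∑ k, Γ (stdBasis n k) • recip (G z) k) v = Γ v := by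
    rw [← sum_smul_recip hGz Γ v, hG z]; rfl
  have hsum : (∑ k, ((1 / 2 : ℝ) * (D (X z) (X z) (stdBasis n k) +
      D (X z) (X z) (stdBasis n k) - D (stdBasis n k) (X z) (X z))) • recip (G z) k) =
      ∑ k, Γ (stdBasis n k) • recip (G z) k := rfl
  rw [hsum, map_add, add_apply]
  -- With denominators cleared, this is the product rule for G = |b|² h, X = l b and F = |b|² l. The
  -- derivatives of `l` and of |b|² in the direction `v` cancel or combine into dη. Only the
  -- symmetry of `h z` itself is needed, since in the terms that are derivatives of `h` along `v`
  -- both slots hold `b`.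
  have key : h z (b z) (b z) * h z (fderivWithin ℝ X S z (X z)) v + Γ v =
      h z (b z) (b z) * (l z ^ 2 * extDerivWithin (fun y => flatForm (h y) (b y)) S z ![b z, v]) +
        fderivWithin ℝ F S z (b z) * (l z * h z (b z) v) := by
    rw [extDerivWithin_flatForm hS hh' hb']
    have e : Γ v = (1 / 2 : ℝ) * (D (X z) (X z) v + D (X z) (X z) v - D v (X z) (X z)) := rfl
    rw [e, hD, hG'.fderivWithin hS, hX'.fderivWithin hS, hF'.fderivWithin hS, hX]
    simp [hp.symm (b z) (b' v), hp.symm (b z) (b' (b z))]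
    ring
  have h0 := hNpos.ne'
  rw [← hΓ] at key
  field_simp
  linear_combination key

end Calculus

/-! ### Pulling back scalar products, volume forms and orientations. -/

section PullbackAlgebra

variable {m n : ℕ}

theorem det_gram_bilinearComp (g : Euc n →L[ℝ] Euc n →L[ℝ] ℝ) (P : Euc n →L[ℝ] Euc n) :
    (gram (g.bilinearComp P P)).det = LinearMap.det (P : Euc n →ₗ[ℝ] Euc n) ^ 2 * (gram g).det := by
  set A := LinearMap.toMatrix (stdBasis n) (stdBasis n) (P : Euc n →ₗ[ℝ] Euc n) with hA
  have hP : ∀ i, P (stdBasis n i) = ∑ k, A k i • stdBasis n k := fun i => by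
    conv_lhs => rw [← (stdBasis n).sum_repr (P (stdBasis n i))]
    simp [hA, LinearMap.toMatrix_apply]
  have : gram (g.bilinearComp P P) = Aᵀ * gram g * A := by
    ext i j
    rw [Matrix.mul_apply]
    simp only [Matrix.mul_apply, gram, Matrix.of_apply, Matrix.transpose_apply,
      ContinuousLinearMap.bilinearComp_apply, hP, map_sum, map_smul, smul_eq_mul, Finset.sum_mul,
      sum_apply, smul_apply, Finset.mul_sum]
    refine Finset.sum_congr rfl fun k _ => Finset.sum_congr rfl fun l _ => ?_
    ring
  rw [this, Matrix.det_mul, Matrix.det_mul, Matrix.det_transpose, hA, LinearMap.det_toMatrix]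
  ring

theorem detForm_curryLeft_comp (P : Euc (m + 1) →L[ℝ] Euc (m + 1)) (v : Euc (m + 1)) :
    ((detForm (m + 1)).curryLeft (P v)).compContinuousLinearMap P =
      LinearMap.det (P : Euc (m + 1) →ₗ[ℝ] Euc (m + 1)) • (detForm (m + 1)).curryLeft v := by
  ext w
  have := detForm_comp (P : Euc (m + 1) →ₗ[ℝ] Euc (m + 1)) (Matrix.vecCons v w)
  refine Eq.trans ?_ this
  rw [ContinuousAlternatingMap.compContinuousLinearMap_apply,
    ContinuousAlternatingMap.curryLeft_apply_apply]
  refine congrArg (fun u => detForm (m + 1) u) (funext fun i => ?_)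
  refine Fin.cases ?_ (fun j => ?_) i <;> simp [Matrix.vecCons]

/-- The sign of the orientation that is obtained from `o` with the isomorphism `P`. -/
def pullbackSign (o : Orientation ℝ (Euc n) (Fin n)) (P : Euc n →L[ℝ] Euc n) : ℝ :=
  orientSign o * SignType.sign (LinearMap.det (P : Euc n →ₗ[ℝ] Euc n))

/-- The formula for the vector `v` with `P v = B`, where `B` is associated to `β`. -/
theorem eq_of_assocVector_eq {g : Euc (m + 1) →L[ℝ] Euc (m + 1) →L[ℝ] ℝ} (hg : IsScalarProduct g)
    (o : Orientation ℝ (Euc (m + 1)) (Fin (m + 1))) (β : Euc (m + 1) [⋀^Fin m]→L[ℝ] ℝ)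
    {P : Euc (m + 1) →L[ℝ] Euc (m + 1)}
    (hP : LinearMap.det (P : Euc (m + 1) →ₗ[ℝ] Euc (m + 1)) ≠ 0) {v : Euc (m + 1)}
    (hv : P v = assocVector g o β) :
    v = (pullbackSign o P * Real.sqrt (gram (g.bilinearComp P P)).det)⁻¹ •
      (detEquiv m).symm (β.compContinuousLinearMap P) := by
  have h := volForm_curryLeft_assocVector hg o β
  have hc := coeff_volForm_ne_zero hg o
  set d := LinearMap.det (P : Euc (m + 1) →ₗ[ℝ] Euc (m + 1)) with hd
  -- The square root sees only |det P|; the sign built into `pullbackSign` restores det P.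
  have h1 : pullbackSign o P * Real.sqrt (gram (g.bilinearComp P P)).det =
      orientSign o * Real.sqrt (gram g).det * d := by
    rw [det_gram_bilinearComp, Real.sqrt_mul (sq_nonneg _), Real.sqrt_sq_eq_abs, pullbackSign,
      ← hd]
    conv_rhs => rw [← sign_mul_abs d]
    ring
  have h2 : β.compContinuousLinearMap P = (orientSign o * Real.sqrt (gram g).det * d) •
      detEquiv m v := by
    rw [← h, volForm_curryLeft, ← hv]
    refine Eq.trans ?_ (smul_smul _ _ _)
    rw [detEquiv_apply, detEquiv_apply, ← detForm_curryLeft_comp]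
    rfl
  rw [h1, h2, map_smul, ContinuousLinearEquiv.symm_apply_apply, smul_smul,
    inv_mul_cancel₀ (mul_ne_zero hc hP), one_smul]

theorem IsScalarProduct.bilinearComp {g : Euc n →L[ℝ] Euc n →L[ℝ] ℝ} (hg : IsScalarProduct g)
    {P : Euc n →L[ℝ] Euc n} (hP : Injective P) : IsScalarProduct (g.bilinearComp P P) where
  symm v w := hg.symm (P v) (P w)
  pos v hv := hg.pos (P v) fun h => hv (hP (h.trans (map_zero P).symm))

/-- There are only two orientations, and `A` exchanges them exactly when its determinant is
negative. -/
theorem orientSign_map (o : Orientation ℝ (Euc n) (Fin n)) (A : Euc n ≃ₗ[ℝ] Euc n) :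
    orientSign (Orientation.map (Fin n) A o) =
      orientSign o * SignType.sign (LinearMap.det (A : Euc n →ₗ[ℝ] Euc n)) := by
  have hcard : Fintype.card (Fin n) = Module.finrank ℝ (Euc n) := by simp
  have hdet : LinearMap.det (A : Euc n →ₗ[ℝ] Euc n) ≠ 0 := A.isUnit_det'.ne_zero
  rcases lt_or_gt_of_ne hdet with h | h
  · rw [(o.map_eq_neg_iff_det_neg A hcard).2 h, sign_neg h]
    have h1 : orientSign (-(stdBasis n).orientation) = -1 :=
      if_neg (Module.Ray.ne_neg_self _)
    have h2 : orientSign (stdBasis n).orientation = 1 := if_pos rfl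
    rcases (stdBasis n).orientation_eq_or_eq_neg o with rfl | rfl
    · simp [h1, h2]
    · have h3 : - -(stdBasis n).orientation = (stdBasis n).orientation :=
        ((stdBasis n).orientation_eq_or_eq_neg _).resolve_right fun h =>
          Module.Ray.ne_neg_self (-(stdBasis n).orientation) h.symm
      rw [h1]
      refine (congrArg orientSign h3).trans ?_
      rw [h2]; simp
  · rw [(o.map_eq_iff_det_pos A hcard).2 h, sign_pos h]
    simp

end PullbackAlgebra

/-! ### Derivatives of charts and the orientation sign. -/

section Charts

variable {n m : ℕ} {H : Type*} [TopologicalSpace H] {I : ModelWithCorners ℝ (Euc n) H}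
  {M : Type*} [TopologicalSpace M] [ChartedSpace H M]

/-- The derivative of the inverse of the chart at `x₀`, as a map of `ℝⁿ`. -/
def chartInvMap (I : ModelWithCorners ℝ (Euc n) H) (x₀ : M) (z : Euc n) : Euc n →L[ℝ] Euc n :=
  chartInvDeriv (I := I) x₀ z

/-- The derivative of the chart at `x₀`, as a map of `ℝⁿ`. -/
def chartMap (I : ModelWithCorners ℝ (Euc n) H) (x₀ x : M) : Euc n →L[ℝ] Euc n :=
  mfderiv I 𝓘(ℝ, Euc n) (extChartAt I x₀) x

/-- The orientation at `x`, as an orientation of `ℝⁿ`. -/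
def TangentOrientation.orientAt (o : TangentOrientation I M) (x : M) :
    Orientation ℝ (Euc n) (Fin n) := o.orient x

variable [IsManifold I 1 M]

theorem chartInvMap_comp_chartMap {x₀ : M} {z : Euc n} (hz : z ∈ (extChartAt I x₀).target) :
    (chartInvMap I x₀ z).comp (chartMap I x₀ ((extChartAt I x₀).symm z)) =
      ContinuousLinearMap.id ℝ (Euc n) :=
  mfderivWithin_extChartAt_symm_comp_mfderiv_extChartAt hz

theorem chartMap_comp_chartInvMap {x₀ : M} {z : Euc n} (hz : z ∈ (extChartAt I x₀).target) :
    (chartMap I x₀ ((extChartAt I x₀).symm z)).comp (chartInvMap I x₀ z) =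
      ContinuousLinearMap.id ℝ (Euc n) :=
  mfderiv_extChartAt_comp_mfderivWithin_extChartAt_symm hz

theorem chartMap_self (x : M) : chartMap I x x = ContinuousLinearMap.id ℝ (Euc n) :=
  mfderiv_extChartAt_self

theorem chartInvMap_self (x : M) :
    chartInvMap I x (extChartAt I x x) = ContinuousLinearMap.id ℝ (Euc n) :=
  mfderivWithin_range_extChartAt_symm

theorem chartInvMap_injective {x₀ : M} {z : Euc n} (hz : z ∈ (extChartAt I x₀).target) :
    Injective (chartInvMap I x₀ z) := fun u v h => by
  have e := chartMap_comp_chartInvMap hz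
  have h1 := congrArg (fun f => f u) e
  have h2 := congrArg (fun f => f v) e
  simp only [ContinuousLinearMap.comp_apply, ContinuousLinearMap.id_apply] at h1 h2
  rw [← h1, ← h2, h]

theorem det_chartInvMap_mul_det_chartMap {x₀ : M} {z : Euc n}
    (hz : z ∈ (extChartAt I x₀).target) :
    LinearMap.det (chartInvMap I x₀ z : Euc n →ₗ[ℝ] Euc n) *
      LinearMap.det (chartMap I x₀ ((extChartAt I x₀).symm z) : Euc n →ₗ[ℝ] Euc n) = 1 := by
  rw [← LinearMap.det_comp]
  refine Eq.trans (congrArg _ ?_) LinearMap.det_id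
  exact congrArg (fun f : Euc n →L[ℝ] Euc n => (f : Euc n →ₗ[ℝ] Euc n))
    (chartInvMap_comp_chartMap hz)

theorem chartInvMap_vectorInChart {x₀ : M} {z : Euc n} (hz : z ∈ (extChartAt I x₀).target)
    (X : VField I M) :
    chartInvMap I x₀ z (vectorInChart x₀ X z) = X ((extChartAt I x₀).symm z) :=
  (isInvertible_mfderivWithin_extChartAt_symm hz).self_apply_inverse _

theorem chartMap_eq_tangentCoordChange {x₀ y : M} (hy : y ∈ (extChartAt I x₀).source) :
    chartMap I x₀ y = tangentCoordChange I y x₀ y := by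
  have hy' : y ∈ (chartAt H x₀).source := by rwa [extChartAt_source] at hy
  exact (TangentBundle.continuousLinearMapAt_trivializationAt hy').symm.trans
    (TangentBundle.continuousLinearMapAt_trivializationAt_eq_core hy')

/-- The cocycle rule splits the derivative of the chart at `x₀` into a transition map, continuous in
`y`, and the derivative of the chart at `x`, in which the orientation is known to be constant near
`x`. -/
theorem chartMap_eq_comp {x₀ x y : M} (hy : y ∈ (extChartAt I x₀).source)
    (hy' : y ∈ (extChartAt I x).source) :
    chartMap I x₀ y = (tangentCoordChange I x x₀ y).comp (chartMap I x y) := by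
  rw [chartMap_eq_tangentCoordChange hy, chartMap_eq_tangentCoordChange hy']
  ext1 v
  exact (tangentCoordChange_comp ⟨⟨mem_extChartAt_source y, hy'⟩, hy⟩).symm

theorem det_chartMap_ne_zero {x₀ y : M} (hy : y ∈ (extChartAt I x₀).source) :
    LinearMap.det (chartMap I x₀ y : Euc n →ₗ[ℝ] Euc n) ≠ 0 := fun h => by
  have := det_chartInvMap_mul_det_chartMap ((extChartAt I x₀).map_source hy)
  rw [(extChartAt I x₀).left_inv hy, h, mul_zero] at this
  exact zero_ne_one this

/-- The sign of the orientation at `y` in the chart at `x₀`. -/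
def TangentOrientation.chartSign (o : TangentOrientation I M) (x₀ y : M) : ℝ :=
  orientSign (o.orientAt y) * SignType.sign (LinearMap.det (chartMap I x₀ y : Euc n →ₗ[ℝ] Euc n))

omit [IsManifold I 1 M] in
theorem TangentOrientation.chartSign_self_eventually (o : TangentOrientation I M) (x : M) :
    ∃ c, ∀ᶠ y in 𝓝 x, o.chartSign x y = c := by
  obtain ⟨s, hs⟩ := o.locallyConstant x
  refine ⟨orientSign s, hs.mono fun y hy => ?_⟩
  obtain ⟨A, hA, hA'⟩ := hy
  have h := orientSign_map (o.orientAt y) (A.toLinearEquiv : Euc n ≃ₗ[ℝ] Euc n)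
  have h1 : orientSign s = _ := (congrArg orientSign hA').symm.trans h
  rw [h1, TangentOrientation.chartSign]
  have h2 : chartMap I x y = ((show Euc n ≃L[ℝ] Euc n from A) : Euc n →L[ℝ] Euc n) := hA.symm
  rw [h2]
  rfl

/-- The orientation axiom gives constancy near `x` in the chart at `x`. The chart at `x₀` changes
the sign by that of the transition determinant, which is continuous and nonzero at `x`, so its sign
is constant nearby. -/
theorem TangentOrientation.chartSign_eventually_eq (o : TangentOrientation I M) {x₀ x : M}
    (hx : x ∈ (extChartAt I x₀).source) :
    ∀ᶠ y in 𝓝 x, o.chartSign x₀ y = o.chartSign x₀ x := by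
  obtain ⟨c, hc⟩ := o.chartSign_self_eventually x
  have hxx := mem_extChartAt_source (I := I) x
  let T : M → ℝ := fun y =>
    LinearMap.det (tangentCoordChange I x x₀ y : Euc n →ₗ[ℝ] Euc n)
  have hT : ∀ y, y ∈ (extChartAt I x₀).source → y ∈ (extChartAt I x).source →
      o.chartSign x₀ y = SignType.sign (T y) * o.chartSign x y := by
    intro y hy hy'
    have hd : LinearMap.det (chartMap I x₀ y : Euc n →ₗ[ℝ] Euc n) =
        T y * LinearMap.det (chartMap I x y : Euc n →ₗ[ℝ] Euc n) := by
      rw [chartMap_eq_comp hy hy', ← LinearMap.det_comp]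
      rfl
    rw [TangentOrientation.chartSign, TangentOrientation.chartSign, hd, sign_mul]
    push_cast
    ring
  have hTx : T x ≠ 0 := by
    intro h0
    refine det_chartMap_ne_zero hx ?_
    rw [chartMap_eq_comp hx hxx]
    refine (LinearMap.det_comp _ _).trans ?_
    change T x * _ = 0
    rw [h0, zero_mul]
  have hopen : (extChartAt I x).source ∩ (extChartAt I x₀).source ∈ 𝓝 x :=
    inter_mem (extChartAt_source_mem_nhds x) ((isOpen_extChartAt_source x₀).mem_nhds hx)
  have hcont : ContinuousAt T x := by
    have h1 : ContinuousAt (tangentCoordChange I x x₀) x :=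
      (continuousOn_tangentCoordChange x x₀).continuousAt hopen
    exact (ContinuousLinearMap.continuous_det (𝕜 := ℝ) (E := Euc n)).continuousAt.comp h1
  have hsign : ∀ᶠ y in 𝓝 x, SignType.sign (T y) = SignType.sign (T x) := by
    rcases lt_or_gt_of_ne hTx with h | h
    · filter_upwards [hcont.eventually_lt_const h] with y hy
      rw [sign_neg hy, sign_neg h]
    · filter_upwards [hcont.eventually_const_lt h] with y hy
      rw [sign_pos hy, sign_pos h]
  filter_upwards [hopen, hsign, hc] with y hy hsy hcy
  rw [hT y hy.2 hy.1, hT x hx hxx, hsy, hcy, hc.self_of_nhds]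

end Charts

/-! ### Smoothness of the metric in charts. -/

section Smoothness

variable {m n : ℕ}

theorem contDiff_det_gram : ContDiff ℝ ∞ fun g : Euc n →L[ℝ] Euc n →L[ℝ] ℝ => (gram g).det := by
  simp only [Matrix.det_apply, gram, Matrix.of_apply]
  refine ContDiff.sum fun σ _ => ContDiff.const_smul _ (contDiff_prod fun i _ => ?_)
  exact (contDiff_id.clm_apply contDiff_const).clm_apply contDiff_const

variable {H : Type*} [TopologicalSpace H] {I : ModelWithCorners ℝ (Euc n) H}
  {M : Type*} [TopologicalSpace M] [ChartedSpace H M] [IsManifold I ∞ M]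

-- Smoothness of a bundle section is smoothness in a trivialization. The inverse of the tangent
-- trivialization at `x₀` is the derivative of the inverse chart, so the two coordinate expressions
-- agree.
set_option synthInstance.maxHeartbeats 400000 in
theorem contDiffOn_bilinInChart
    (g : Bundle.ContMDiffRiemannianMetric I ∞ (Euc n) (fun x : M => TangentSpace I x)) (x₀ : M) :
    ContDiffOn ℝ ∞ (bilinInChart x₀ g.inner) (extChartAt I x₀).target := by
  let e := trivializationAt (Euc n →L[ℝ] Euc n →L[ℝ] ℝ)
    (fun x : M => TangentSpace I x →L[ℝ] TangentSpace I x →L[ℝ] ℝ) x₀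
  have hbase : e.baseSet = (chartAt H x₀).source := by
    simp [e]
  have h1 := (e.contMDiffOn_section_baseSet_iff (IB := I) (n := ∞)).1 g.contMDiff.contMDiffOn
  rw [hbase] at h1
  have h2 := h1.comp (contMDiffOn_extChartAt_symm (I := I) (n := ∞) x₀) (fun z hz => by
    rw [← extChartAt_source I]; exact (extChartAt I x₀).map_target hz)
  rw [contMDiffOn_iff_contDiffOn] at h2
  refine h2.congr fun z hz => ?_
  have hy : (extChartAt I x₀).symm z ∈ (chartAt H x₀).source := by
    rw [← extChartAt_source I]; exact (extChartAt I x₀).map_target hz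
  ext1 v
  ext1 w
  have h3 := inCoordinates_apply_eq₂ (𝕜 := ℝ) (B := M) (F₁ := Euc n)
    (F₂ := Euc n) (F₃ := ℝ) (E₁ := fun x : M => TangentSpace I x)
    (E₂ := fun x : M => TangentSpace I x) (E₃ := Bundle.Trivial M ℝ) (x₀ := x₀)
    (ϕ := g.inner ((extChartAt I x₀).symm z)) (v := v) (w := w) hy hy (mem_univ _)
  refine Eq.trans ?_ h3.symm
  have h4 : ∀ u, (trivializationAt (Euc n) (fun x : M => TangentSpace I x) x₀).symm
      ((extChartAt I x₀).symm z) u = chartInvMap I x₀ z u := by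
    intro u
    have h5 := congrArg (fun f => f u) (TangentBundle.symmL_trivializationAt (I := I) hy)
    rw [(extChartAt I x₀).right_inv hz] at h5
    exact (Bundle.Trivialization.symmL_apply _ hy u).symm.trans h5
  rw [h4, h4]
  simp
  rfl

end Smoothness

theorem starForm_comp {m : ℕ} {g : Euc (m + 1) →L[ℝ] Euc (m + 1) →L[ℝ] ℝ}
    (hg : IsScalarProduct g) (o : Orientation ℝ (Euc (m + 1)) (Fin (m + 1)))
    (β : Euc (m + 1) [⋀^Fin m]→L[ℝ] ℝ) {P : Euc (m + 1) →L[ℝ] Euc (m + 1)} {v : Euc (m + 1)}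
    (hv : P v = assocVector g o β) :
    (starForm (Nat.add_comm m 1) g o β).compContinuousLinearMap P =
      (-1 : ℝ) ^ m • flatForm (g.bilinearComp P P) v := by
  rw [starForm_eq hg, ← hv]
  rfl

/-! ### The field B and the form ⋆β in an arbitrary chart. -/

section FluxInChart

variable {m : ℕ} {H : Type*} [TopologicalSpace H] {I : ModelWithCorners ℝ (Euc (m + 1)) H}
  {M : Type*} [TopologicalSpace M] [ChartedSpace H M]

variable {g : BilinField I M} (hg : ∀ x, IsScalarProduct (n := m + 1) (g x))
  (o : TangentOrientation I M) (β : DForm I M m)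

section

variable [IsManifold I 1 M] {x₀ : M} {z : Euc (m + 1)}

include hg in
theorem isScalarProduct_bilinInChart (hz : z ∈ (extChartAt I x₀).target) :
    IsScalarProduct (bilinInChart x₀ g z) :=
  (hg _).bilinearComp (chartInvMap_injective hz)

theorem bilinInChart_vectorInChart (hz : z ∈ (extChartAt I x₀).target) (X Y : VField I M) :
    bilinInChart x₀ g z (vectorInChart x₀ X z) (vectorInChart x₀ Y z) =
      g ((extChartAt I x₀).symm z) (X ((extChartAt I x₀).symm z))
        (Y ((extChartAt I x₀).symm z)) := by
  rw [← chartInvMap_vectorInChart hz X, ← chartInvMap_vectorInChart hz Y]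
  rfl

include hg in
theorem formNormSq_in_chart (hz : z ∈ (extChartAt I x₀).target) :
    formNormSq (n := m + 1) (g ((extChartAt I x₀).symm z)) (β ((extChartAt I x₀).symm z)) =
      bilinInChart x₀ g z (vectorInChart x₀ (assocField g o β) z)
        (vectorInChart x₀ (assocField g o β) z) := by
  rw [bilinInChart_vectorInChart hz]
  exact formNormSq_eq (hg _) (o.orientAt _) _

include hg in
theorem formInChart_starFlux (hz : z ∈ (extChartAt I x₀).target) :
    formInChart x₀ (starFlux g o β) z = (-1 : ℝ) ^ m •
      flatForm (bilinInChart x₀ g z) (vectorInChart x₀ (assocField g o β) z) := by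
  exact starForm_comp (hg _) (o.orientAt _) _ (chartInvMap_vectorInChart hz (assocField g o β))

-- This formula holds on the whole chart target and isolates the orientation in one sign, so the
-- smoothness of `B` reduces to that of the metric and of β.
include hg in
theorem vectorInChart_assocField (hz : z ∈ (extChartAt I x₀).target) :
    vectorInChart x₀ (assocField g o β) z =
      (o.chartSign x₀ ((extChartAt I x₀).symm z) *
        Real.sqrt (gram (bilinInChart x₀ g z)).det)⁻¹ •
      (detEquiv m).symm (formInChart x₀ β z) := by
  have hd := det_chartInvMap_mul_det_chartMap hz
  have hP : LinearMap.det (chartInvMap I x₀ z : Euc (m + 1) →ₗ[ℝ] Euc (m + 1)) ≠ 0 :=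
    left_ne_zero_of_mul_eq_one hd
  have h := eq_of_assocVector_eq (hg ((extChartAt I x₀).symm z))
    (o.orientAt ((extChartAt I x₀).symm z)) (β ((extChartAt I x₀).symm z)) hP
    (chartInvMap_vectorInChart hz (assocField g o β))
  refine h.trans ?_
  have hs : pullbackSign (o.orientAt ((extChartAt I x₀).symm z)) (chartInvMap I x₀ z) =
      o.chartSign x₀ ((extChartAt I x₀).symm z) := by
    rw [pullbackSign, TangentOrientation.chartSign]
    congr 2
    -- The determinants of the chart derivative and of its inverse have product 1, hence equal
    -- signs.
    have h1 := congrArg SignType.sign hd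
    rw [sign_mul, sign_one] at h1
    revert h1
    generalize SignType.sign (LinearMap.det (chartInvMap I x₀ z : Euc (m + 1) →ₗ[ℝ] _)) = a
    generalize SignType.sign (LinearMap.det (chartMap I x₀ ((extChartAt I x₀).symm z) :
      Euc (m + 1) →ₗ[ℝ] _)) = b
    revert a b
    decide
  rw [hs]
  rfl

end

variable [IsManifold I ∞ M]

theorem isScalarProduct_inner
    (g : Bundle.ContMDiffRiemannianMetric I ∞ (Euc (m + 1)) (fun x : M => TangentSpace I x))
    (x : M) : IsScalarProduct (n := m + 1) (g.inner x) where
  symm := g.symm x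
  pos := g.pos x

/-- The vector field associated to a smooth form is smooth. -/
theorem contDiffOn_vectorInChart_assocField
    (g : Bundle.ContMDiffRiemannianMetric I ∞ (Euc (m + 1)) (fun x : M => TangentSpace I x))
    (hβ : SmoothOn β univ) (x₀ : M) :
    ContDiffOn ℝ ∞ (vectorInChart x₀ (assocField g.inner o β)) (extChartAt I x₀).target := by
  have : IsManifold I 1 M := IsManifold.of_le (n := ∞) (by norm_num)
  have hg := isScalarProduct_inner g
  intro z hz
  have hdet : 0 < (gram (bilinInChart x₀ g.inner z)).det :=
    det_gram_pos (isScalarProduct_bilinInChart hg hz)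
  have hsrc := (extChartAt I x₀).map_target hz
  have hsgn : ∀ᶠ y in 𝓝[(extChartAt I x₀).target] z,
      o.chartSign x₀ ((extChartAt I x₀).symm y) = o.chartSign x₀ ((extChartAt I x₀).symm z) :=
    (continuousOn_extChartAt_symm x₀ z hz).eventually (o.chartSign_eventually_eq hsrc)
  have hne : o.chartSign x₀ ((extChartAt I x₀).symm z) ≠ 0 := by
    rw [TangentOrientation.chartSign]
    refine mul_ne_zero (left_ne_zero_of_mul_eq_one (orientSign_mul_self _)) ?_
    rcases lt_or_gt_of_ne (det_chartMap_ne_zero hsrc) with h | h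
    · rw [sign_neg h]; simp
    · rw [sign_pos h]; simp
  have hb := contDiffOn_bilinInChart g x₀ z hz
  have hform : ContDiffWithinAt ℝ ∞ (formInChart x₀ β) (extChartAt I x₀).target z := by
    have := hβ x₀
    rw [preimage_univ, inter_univ] at this
    exact this z hz
  have hgram : ContDiffWithinAt ℝ ∞ (fun y => (gram (bilinInChart x₀ g.inner y)).det)
      (extChartAt I x₀).target z := contDiff_det_gram.contDiffAt.comp_contDiffWithinAt z hb
  -- The sign is frozen at its value at `z`; by `hsgn` this changes nothing near `z`.
  have hmain : ContDiffWithinAt ℝ ∞ (fun y =>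
      (o.chartSign x₀ ((extChartAt I x₀).symm z) *
        Real.sqrt (gram (bilinInChart x₀ g.inner y)).det)⁻¹ •
      (detEquiv m).symm (formInChart x₀ β y)) (extChartAt I x₀).target z := by
    have h1 : ContDiffWithinAt ℝ ∞ (fun y => o.chartSign x₀ ((extChartAt I x₀).symm z) *
        Real.sqrt (gram (bilinInChart x₀ g.inner y)).det) (extChartAt I x₀).target z :=
      contDiffWithinAt_const.mul (hgram.sqrt hdet.ne')
    exact (h1.inv (mul_ne_zero hne (Real.sqrt_pos.2 hdet).ne')).smul
      ((detEquiv m).symm.contDiff.contDiffAt.comp_contDiffWithinAt z hform)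
  refine hmain.congr_of_eventuallyEq_of_mem ?_ hz
  filter_upwards [hsgn, self_mem_nhdsWithin] with y hy hyt
  rw [vectorInChart_assocField hg o β hyt, hy]

theorem smoothOn_starFlux
    (g : Bundle.ContMDiffRiemannianMetric I ∞ (Euc (m + 1)) (fun x : M => TangentSpace I x))
    (hβ : SmoothOn β univ) (U : Set M) : SmoothOn (starFlux g.inner o β) U := by
  have : IsManifold I 1 M := IsManifold.of_le (n := ∞) (by norm_num)
  intro x₀
  suffices h : ContDiffOn ℝ ∞ (formInChart x₀ (starFlux g.inner o β)) (extChartAt I x₀).target from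
    h.mono inter_subset_left
  have h : ContDiffOn ℝ ∞ (fun z => ((-1 : ℝ) ^ m • covectorForm (m + 1))
      (bilinInChart x₀ g.inner z (vectorInChart x₀ (assocField g.inner o β) z)))
      (extChartAt I x₀).target :=
    ((-1 : ℝ) ^ m • covectorForm (m + 1)).contDiff.comp_contDiffOn
      ((contDiffOn_bilinInChart g x₀).clm_apply (contDiffOn_vectorInChart_assocField o β g hβ x₀))
  exact h.congr fun z hz => formInChart_starFlux (isScalarProduct_inner g) o β hz

end FluxInChart

/-! ### Simplifications at the centre of a chart, and the chain rule. -/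

section OwnChart

variable {n : ℕ} {H : Type*} [TopologicalSpace H] {I : ModelWithCorners ℝ (Euc n) H}
  {M : Type*} [TopologicalSpace M] [ChartedSpace H M] [IsManifold I 1 M]

/-- In the identification of the tangent space at `x` with ℝⁿ, the chart at `x` has identity
derivative at `x`. -/
theorem extD_eq {k : ℕ} (α : DForm I M k) (x : M) :
    extD α x = extDerivWithin (formInChart x α) (range I) (extChartAt I x x) := by
  have h : extD α x = ContinuousAlternatingMap.compContinuousLinearMap
      (extDerivWithin (formInChart x α) (range I) (extChartAt I x x)) (chartMap I x x) := rfl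
  rw [h, chartMap_self]
  rfl

theorem vectorInChart_self (X : VField I M) (x : M) :
    vectorInChart x X (extChartAt I x x) = X x := by
  have h := chartInvMap_vectorInChart (mem_extChartAt_target (I := I) x) X
  rw [chartInvMap_self] at h
  exact h.trans (congrArg (fun y => (show Euc n from X y)) (extChartAt_to_inv x))

theorem leviCivita_self (g : BilinField I M) (X : VField I M) (x : M) :
    leviCivita g X X x = (show Euc n from
      fderivWithin ℝ (vectorInChart x X) (range I) (extChartAt I x x)
        (vectorInChart x X (extChartAt I x x)) +
      ∑ k, ((1 / 2 : ℝ) *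
        (fderivWithin ℝ (bilinInChart x g) (range I) (extChartAt I x x)
            (vectorInChart x X (extChartAt I x x)) (vectorInChart x X (extChartAt I x x))
            (stdBasis n k) +
          fderivWithin ℝ (bilinInChart x g) (range I) (extChartAt I x x)
            (vectorInChart x X (extChartAt I x x)) (vectorInChart x X (extChartAt I x x))
            (stdBasis n k) -
          fderivWithin ℝ (bilinInChart x g) (range I) (extChartAt I x x) (stdBasis n k)
            (vectorInChart x X (extChartAt I x x)) (vectorInChart x X (extChartAt I x x)))) •
        recip (bilinInChart x g (extChartAt I x x)) k) := by
  have h : leviCivita g X X x = (chartMap I x x).inverse (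
      fderivWithin ℝ (vectorInChart x X) (range I) (extChartAt I x x)
        (vectorInChart x X (extChartAt I x x)) +
      ∑ k, christoffel g x (vectorInChart x X (extChartAt I x x))
        (vectorInChart x X (extChartAt I x x)) (stdBasis n k) •
          recip (bilinInChart x g (extChartAt I x x)) k) := rfl
  rw [h, chartMap_self, ContinuousLinearMap.inverse_id]
  rfl

/-- This expresses a directional derivative at nearby points in one fixed chart, as is needed to see
that ρ is smooth. -/
theorem mvfderiv_in_chart {F : M → ℝ} {x₀ : M} {z : Euc n} (hz : z ∈ (extChartAt I x₀).target)
    (hF : MDifferentiableAt I 𝓘(ℝ, ℝ) F ((extChartAt I x₀).symm z)) (X : VField I M) :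
    mvfderiv I F ((extChartAt I x₀).symm z) (X ((extChartAt I x₀).symm z)) =
      fderivWithin ℝ (F ∘ (extChartAt I x₀).symm) (range I) z (vectorInChart x₀ X z) := by
  have hU : UniqueMDiffWithinAt 𝓘(ℝ, Euc n) (range I) z :=
    I.uniqueMDiffOn _ (extChartAt_target_subset_range x₀ hz)
  have h := mfderiv_comp_mfderivWithin z hF (mdifferentiableWithinAt_extChartAt_symm hz) hU
  rw [mfderivWithin_eq_fderivWithin] at h
  rw [← chartInvMap_vectorInChart hz X, h]
  rfl

end OwnChart

/-! ### Harmonic versus eikonal, with the exact versions. -/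

section Equivalences

variable {m : ℕ} {H : Type*} [TopologicalSpace H] {I : ModelWithCorners ℝ (Euc (m + 1)) H}
  {M : Type*} [TopologicalSpace M] [ChartedSpace H M] [IsManifold I 1 M]
  {o : TangentOrientation I M} {β : DForm I M m}

/-- The set U is open by continuity of β. Neighbourhoods within `range I` are used so that boundary
points are covered. -/
theorem eventually_mem_nonvanishing (hβ : SmoothOn β univ) {x : M} (hx : x ∈ nonvanishing β) :
    ∀ᶠ z in 𝓝[range I] (extChartAt I x x),
      z ∈ (extChartAt I x).target ∧ (extChartAt I x).symm z ∈ nonvanishing β := by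
  have hz := mem_extChartAt_target (I := I) x
  have hc : ContDiffOn ℝ ∞ (formInChart x β) (extChartAt I x).target := by
    have := hβ x
    rwa [preimage_univ, inter_univ] at this
  have h0 : formInChart x β (extChartAt I x x) ≠ 0 := by
    have h1 : formInChart x β (extChartAt I x x) =
        ContinuousAlternatingMap.compContinuousLinearMap
          (show Euc (m + 1) [⋀^Fin m]→L[ℝ] ℝ from β ((extChartAt I x).symm (extChartAt I x x)))
          (chartInvMap I x (extChartAt I x x)) := rfl
    rw [h1, chartInvMap_self]
    have h2 : ∀ y, y = x → (show Euc (m + 1) [⋀^Fin m]→L[ℝ] ℝ from β y) ≠ 0 := by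
      rintro y rfl
      exact hx
    exact h2 _ (extChartAt_to_inv x)
  rw [← nhdsWithin_extChartAt_target_eq]
  filter_upwards [(hc.continuousOn _ hz).eventually_ne h0, self_mem_nhdsWithin] with z h1 h2
  refine ⟨h2, fun h3 => h1 ?_⟩
  have h4 : formInChart x β z = ContinuousAlternatingMap.compContinuousLinearMap
      (show Euc (m + 1) [⋀^Fin m]→L[ℝ] ℝ from β ((extChartAt I x).symm z))
      (chartInvMap I x z) := rfl
  rw [h4]
  have h5 : (show Euc (m + 1) [⋀^Fin m]→L[ℝ] ℝ from β ((extChartAt I x).symm z)) = 0 := h3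
  rw [h5]
  rfl

/-- The exterior derivative is local and U is open, so equality on U suffices. -/
theorem extD_congr_nonvanishing (hβ : SmoothOn β univ) {k : ℕ} {ξ η : DForm I M k}
    (h : ∀ x ∈ nonvanishing β, ξ x = η x) {x : M} (hx : x ∈ nonvanishing β) :
    extD ξ x = extD η x := by
  rw [extD_eq, extD_eq]
  have he : formInChart x ξ =ᶠ[𝓝[range I] (extChartAt I x x)] formInChart x η := by
    filter_upwards [eventually_mem_nonvanishing hβ hx] with z hz
    rw [formInChart, h _ hz.2]
    rfl
  have h0 := he.self_of_nhdsWithin (mem_range_self _)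
  unfold extDerivWithin
  rw [he.fderivWithin_eq h0]

variable {g : BilinField I M} (hg : ∀ x, IsScalarProduct (n := m + 1) (g x))

omit [IsManifold I 1 M] in
include hg in
theorem isNormalizationOn_iff (ξ : DForm I M 1) :
    IsNormalizationOn (conformalMetric g β) (starFlux (conformalMetric g β) o β) ξ
      (nonvanishing β) ↔ ∀ x ∈ nonvanishing β, ξ x = starFlux g o β x :=
  forall₂_congr fun x hx => isNormalization_iff (hg x) (o.orientAt x) hx (ξ x)

-- By uniqueness of the normalization, η can only be ⋆β for `g`, so closedness of η on U is the
-- harmonic condition. The hypothesis `hs` supplies the smoothness of η.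
include hg in
theorem isHarmonicOn_iff_isEikonalOn (hβ : SmoothOn β univ)
    (hs : SmoothOn (starFlux g o β) (nonvanishing β)) :
    IsHarmonicOn g o β (nonvanishing β) ↔
      IsEikonalOn (conformalMetric g β) o β (nonvanishing β) := by
  constructor
  · intro h
    exact ⟨starFlux g o β, hs, (isNormalizationOn_iff hg _).2 fun _ _ => rfl, h⟩
  · rintro ⟨η, -, hη, hd⟩ x hx
    rw [← extD_congr_nonvanishing hβ ((isNormalizationOn_iff hg η).1 hη) hx]
    exact hd x hx

-- The cases c = ±1 need no differentiability of φ, so the identity holds at every point.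
omit [IsManifold I 1 M] in
theorem dFun_const_mul (φ : M → ℝ) {c : ℝ} (hc : c = 1 ∨ c = -1) (x : M) :
    dFun (I := I) (fun y => c * φ y) x = c • dFun φ x := by
  rcases hc with rfl | rfl
  · simp only [one_mul, one_smul]
  · have h : (fun y => (-1 : ℝ) * φ y) = -φ := by ext y; simp
    rw [h]
    unfold dFun
    rw [mvfderiv_neg]
    exact ContinuousAlternatingMap.ext fun v => (neg_one_mul _).symm

omit [IsManifold I 1 M] in
include hg in
theorem isExactHarmonicOn_iff_isExactEikonalOn :
    IsExactHarmonicOn g o β (nonvanishing β) ↔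
      IsExactEikonalOn (conformalMetric g β) o β (nonvanishing β) := by
  have hc : ((-1 : ℝ) ^ m = 1 ∨ (-1 : ℝ) ^ m = -1) := neg_one_pow_eq_or ℝ m
  have hcc : (-1 : ℝ) ^ m * (-1 : ℝ) ^ m = 1 := by rcases hc with h | h <;> rw [h] <;> norm_num
  have key : ∀ (φ : M → ℝ) (x : M), β x = hodgeStar rfl g o (dFun φ) x ↔
      dFun (fun y => (-1 : ℝ) ^ m * φ y) x = starFlux g o β x := by
    intro φ x
    rw [dFun_const_mul φ hc]
    exact eq_starForm_iff (hg x) (o.orientAt x) (β x) (dFun φ x)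
  constructor
  · rintro ⟨φ, hφ, h⟩
    refine ⟨fun y => (-1 : ℝ) ^ m * φ y, contMDiffOn_const.mul hφ, ?_⟩
    exact (isNormalizationOn_iff hg _).2 fun x hx => (key φ x).1 (h x hx)
  · rintro ⟨φ, hφ, h⟩
    refine ⟨fun y => (-1 : ℝ) ^ m * φ y, contMDiffOn_const.mul hφ, fun x hx => (key _ x).2 ?_⟩
    simp only [← mul_assoc, hcc, one_mul]
    exact (isNormalizationOn_iff hg _).1 h x hx

end Equivalences

/-! ### Force-free versus geodesic. -/

section Geodesic

variable {m : ℕ} {H : Type*} [TopologicalSpace H] {I : ModelWithCorners ℝ (Euc (m + 1)) H}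
  {M : Type*} [TopologicalSpace M] [ChartedSpace H M]

theorem contDiffAt_volFactor {c : ℝ} (hc : 0 < c) : ContDiffAt ℝ ∞ (volFactor m) c := by
  unfold volFactor
  have h : c ^ (m + 1) ≠ 0 := (pow_pos hc _).ne'
  exact ((contDiffAt_id.pow (m + 1)).sqrt h).inv (Real.sqrt_pos.2 (pow_pos hc _)).ne'

theorem contDiffWithinAt_volFactor {f : Euc (m + 1) → ℝ} {S : Set (Euc (m + 1))}
    {z : Euc (m + 1)} (hf : ContDiffWithinAt ℝ ∞ f S z) (hz : 0 < f z) :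
    ContDiffWithinAt ℝ ∞ (fun y => volFactor m (f y)) S z :=
  (contDiffAt_volFactor hz).comp_contDiffWithinAt z hf

/-- The norm of the vector field associated to `β` by the metric `|β|² g`. -/
def conformalSpeed (g : BilinField I M) (β : DForm I M m) (x : M) : ℝ :=
  formNormSq (n := m + 1) (g x) (β x) * volFactor m (formNormSq (n := m + 1) (g x) (β x))

variable {g : BilinField I M} (hg : ∀ x, IsScalarProduct (n := m + 1) (g x))
  (o : TangentOrientation I M) {β : DForm I M m}

include hg in
theorem assocField_conformalMetric {x : M} (hx : x ∈ nonvanishing β) :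
    assocField (conformalMetric g β) o β x =
      volFactor m (formNormSq (n := m + 1) (g x) (β x)) • assocField g o β x :=
  assocVector_smul (hg x) (formNormSq_pos (hg x) (o.orientAt x) hx) (o.orientAt x) (β x)

section

variable [IsManifold I 1 M] {x₀ : M} {z : Euc (m + 1)}

include hg in
theorem vectorInChart_conformalMetric (hz : z ∈ (extChartAt I x₀).target)
    (hzU : (extChartAt I x₀).symm z ∈ nonvanishing β) :
    vectorInChart x₀ (assocField (conformalMetric g β) o β) z =
      volFactor m (bilinInChart x₀ g z (vectorInChart x₀ (assocField g o β) z)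
        (vectorInChart x₀ (assocField g o β) z)) • vectorInChart x₀ (assocField g o β) z := by
  rw [← formNormSq_in_chart hg o β hz]
  unfold vectorInChart
  rw [VectorField.mpullbackWithin_apply, assocField_conformalMetric hg o hzU, map_smul]
  rfl

include hg in
theorem bilinInChart_conformalMetric (hz : z ∈ (extChartAt I x₀).target) :
    bilinInChart x₀ (conformalMetric g β) z =
      bilinInChart x₀ g z (vectorInChart x₀ (assocField g o β) z)
        (vectorInChart x₀ (assocField g o β) z) • bilinInChart x₀ g z := by
  rw [← formNormSq_in_chart hg o β hz]
  rfl

include hg in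
theorem conformalSpeed_in_chart (hz : z ∈ (extChartAt I x₀).target) :
    conformalSpeed g β ((extChartAt I x₀).symm z) =
      bilinInChart x₀ g z (vectorInChart x₀ (assocField g o β) z)
        (vectorInChart x₀ (assocField g o β) z) *
      volFactor m (bilinInChart x₀ g z (vectorInChart x₀ (assocField g o β) z)
        (vectorInChart x₀ (assocField g o β) z)) := by
  rw [conformalSpeed, formNormSq_in_chart hg o β hz]

-- The form ⋆β is η up to the constant factor (-1)ᵐ, which passes through d and ι_B and can be
-- cancelled.
include hg in
theorem isForceFree_iff (x : M) :
    interiorProd (assocField g o β) (extD (starFlux g o β)) x = 0 ↔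
      ∀ v, extDerivWithin (fun z => flatForm (bilinInChart x g z)
        (vectorInChart x (assocField g o β) z)) (range I) (extChartAt I x x)
          ![vectorInChart x (assocField g o β) (extChartAt I x x), v] = 0 := by
  have hz := mem_extChartAt_target (I := I) x
  have hU : UniqueDiffWithinAt ℝ (range I) (extChartAt I x x) :=
    I.uniqueDiffOn _ (mem_range_self _)
  have he : formInChart x (starFlux g o β) =ᶠ[𝓝[range I] (extChartAt I x x)]
      fun z => (-1 : ℝ) ^ m • flatForm (bilinInChart x g z)
        (vectorInChart x (assocField g o β) z) := by
    rw [← nhdsWithin_extChartAt_target_eq]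
    filter_upwards [self_mem_nhdsWithin] with z hz
    exact formInChart_starFlux hg o β hz
  have h1 : extD (starFlux g o β) x = (-1 : ℝ) ^ m • extDerivWithin (fun z =>
      flatForm (bilinInChart x g z) (vectorInChart x (assocField g o β) z)) (range I)
      (extChartAt I x x) := by
    rw [extD_eq, he.extDerivWithin_eq_of_mem (mem_range_self _), extDerivWithin_fun_smul _ _ hU]
  have h2 : interiorProd (assocField g o β) (extD (starFlux g o β)) x =
      (-1 : ℝ) ^ m • ContinuousAlternatingMap.curryLeft (extDerivWithin (fun z =>
      flatForm (bilinInChart x g z) (vectorInChart x (assocField g o β) z)) (range I)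
      (extChartAt I x x)) (vectorInChart x (assocField g o β) (extChartAt I x x)) := by
    rw [interiorProd, h1, vectorInChart_self]
    rfl
  have hne : (-1 : ℝ) ^ m ≠ 0 := by positivity
  rw [h2]
  refine (smul_eq_zero_iff_right hne).trans ?_
  constructor
  · intro h v
    exact congrArg (fun θ : Euc (m + 1) [⋀^Fin 1]→L[ℝ] ℝ => θ ![v]) h
  · intro h
    ext w
    rw [ContinuousAlternatingMap.curryLeft_apply_apply]
    refine Eq.trans ?_ (h (w 0))
    congr 1
    funext i
    fin_cases i <;> rfl

end

variable [IsManifold I ∞ M]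
  (g : Bundle.ContMDiffRiemannianMetric I ∞ (Euc (m + 1)) (fun x : M => TangentSpace I x))

omit [IsManifold I ∞ M] in
theorem contDiffWithinAt_range_of_target {V : Type*} [NormedAddCommGroup V] [NormedSpace ℝ V]
    {x : M} {f : Euc (m + 1) → V} (hf : ContDiffOn ℝ ∞ f (extChartAt I x).target) :
    ContDiffWithinAt ℝ ∞ f (range I) (extChartAt I x x) :=
  (hf _ (mem_extChartAt_target x)).mono_of_mem_nhdsWithin (extChartAt_target_mem_nhdsWithin x)

theorem contDiffWithinAt_normSq (hβ : SmoothOn β univ) (x : M) :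
    ContDiffWithinAt ℝ ∞ (fun z => bilinInChart x g.inner z
      (vectorInChart x (assocField g.inner o β) z) (vectorInChart x (assocField g.inner o β) z))
      (range I) (extChartAt I x x) := by
  have hb := contDiffWithinAt_range_of_target (contDiffOn_vectorInChart_assocField o β g hβ x)
  exact ((contDiffWithinAt_range_of_target (contDiffOn_bilinInChart g x)).clm_apply hb).clm_apply hb

theorem normSq_pos (hβ : SmoothOn β univ) {x : M}
    (hx : x ∈ nonvanishing β) :
    0 < bilinInChart x g.inner (extChartAt I x x)
      (vectorInChart x (assocField g.inner o β) (extChartAt I x x))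
      (vectorInChart x (assocField g.inner o β) (extChartAt I x x)) := by
  have : IsManifold I 1 M := IsManifold.of_le (n := ∞) (by norm_num)
  have hg := isScalarProduct_inner g
  rw [← formNormSq_in_chart hg o β (mem_extChartAt_target x)]
  exact formNormSq_pos (hg ((extChartAt I x).symm (extChartAt I x x)))
    (o.orientAt ((extChartAt I x).symm (extChartAt I x x)))
    ((eventually_mem_nonvanishing hβ hx).self_of_nhdsWithin
      (extChartAt_target_subset_range x (mem_extChartAt_target x))).2

theorem contMDiffAt_conformalSpeed (o : TangentOrientation I M)
    (hβ : SmoothOn β univ) {x : M}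
    (hx : x ∈ nonvanishing β) : ContMDiffAt I 𝓘(ℝ, ℝ) ∞ (conformalSpeed g.inner β) x := by
  have : IsManifold I 1 M := IsManifold.of_le (n := ∞) (by norm_num)
  have hg := isScalarProduct_inner g
  have hN := contDiffWithinAt_normSq o g hβ x
  have hNpos := normSq_pos o g hβ hx
  rw [contMDiffAt_iff_source, contMDiffWithinAt_iff_contDiffWithinAt]
  have hF := hN.mul (contDiffWithinAt_volFactor hN hNpos)
  refine hF.congr_of_eventuallyEq_of_mem ?_ (mem_range_self _)
  filter_upwards [extChartAt_target_mem_nhdsWithin x] with z hz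
  exact conformalSpeed_in_chart hg o hz

/-- The function `ρ` with `∇_B B = ρ B` for the metric `|β|² g`, if there is one. -/
def geodesicFactor (g : BilinField I M) (o : TangentOrientation I M) (β : DForm I M m) (x : M) :
    ℝ :=
  mvfderiv I (conformalSpeed g β) x (assocField (conformalMetric g β) o β x) /
    conformalSpeed g β x

theorem geodesicFactor_in_chart (hβ : SmoothOn β univ) {x₀ : M}
    {z : Euc (m + 1)} (hz : z ∈ (extChartAt I x₀).target)
    (hzU : (extChartAt I x₀).symm z ∈ nonvanishing β) :
    geodesicFactor g.inner o β ((extChartAt I x₀).symm z) =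
      fderivWithin ℝ (conformalSpeed g.inner β ∘ (extChartAt I x₀).symm) (range I) z
        (vectorInChart x₀ (assocField (conformalMetric g.inner β) o β) z) /
      conformalSpeed g.inner β ((extChartAt I x₀).symm z) := by
  have : IsManifold I 1 M := IsManifold.of_le (n := ∞) (by norm_num)
  rw [geodesicFactor, mvfderiv_in_chart hz
    ((contMDiffAt_conformalSpeed g o hβ hzU).mdifferentiableAt (by norm_num))]

/-- In the chart at `x` this is the derivative of a smooth F along the smooth field X, divided by F
> 0. Unique differentiability of `range I` gives smoothness up to the boundary. -/
theorem contMDiffAt_geodesicFactor (hβ : SmoothOn β univ) {x : M}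
    (hx : x ∈ nonvanishing β) : ContMDiffAt I 𝓘(ℝ, ℝ) ∞ (geodesicFactor g.inner o β) x := by
  have : IsManifold I 1 M := IsManifold.of_le (n := ∞) (by norm_num)
  have hg := isScalarProduct_inner g
  have hN := contDiffWithinAt_normSq o g hβ x
  have hNpos := normSq_pos o g hβ hx
  have hF := contMDiffAt_conformalSpeed g o hβ hx
  rw [contMDiffAt_iff_source, contMDiffWithinAt_iff_contDiffWithinAt] at hF
  have hz₀ := mem_range_self (f := I) (chartAt H x x)
  have hX : ContDiffWithinAt ℝ ∞ (vectorInChart x (assocField (conformalMetric g.inner β) o β))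
      (range I) (extChartAt I x x) := by
    have h1 := (contDiffWithinAt_volFactor hN hNpos).smul
      (contDiffWithinAt_range_of_target (contDiffOn_vectorInChart_assocField o β g hβ x))
    refine h1.congr_of_eventuallyEq_of_mem ?_ hz₀
    filter_upwards [eventually_mem_nonvanishing hβ hx] with z hz
    exact vectorInChart_conformalMetric hg o hz.1 hz.2
  have hF0 : (conformalSpeed g.inner β ∘ (extChartAt I x).symm) (extChartAt I x x) ≠ 0 := by
    rw [comp_apply, conformalSpeed_in_chart hg o (mem_extChartAt_target x)]
    exact (mul_pos hNpos (volFactor_pos hNpos)).ne'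
  rw [contMDiffAt_iff_source, contMDiffWithinAt_iff_contDiffWithinAt]
  have hmain := (hF.fderivWithin_right_apply hX I.uniqueDiffOn (by norm_num) hz₀).div hF hF0
  refine hmain.congr_of_eventuallyEq_of_mem ?_ hz₀
  filter_upwards [eventually_mem_nonvanishing hβ hx] with z hz
  exact geodesicFactor_in_chart o g hβ hz.1 hz.2

theorem isForceFreeOn_iff_isGeodesicOn (hβ : SmoothOn β univ) :
    IsForceFreeOn g.inner o β (nonvanishing β) ↔
      IsGeodesicOn (conformalMetric g.inner β) o β (nonvanishing β) := by
  have : IsManifold I 1 M := IsManifold.of_le (n := ∞) (by norm_num)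
  have hg := isScalarProduct_inner g
  -- At each point the problem becomes linear algebra in ℝⁿ: `w` is ∇_X X, `h` is g, X = l b, and
  -- `E` is the covector ι_b dη. The last clause is `conformal_leviCivita`.
  have main : ∀ x ∈ nonvanishing β, ∃ w : Euc (m + 1),
      leviCivita (conformalMetric g.inner β) (assocField (conformalMetric g.inner β) o β)
        (assocField (conformalMetric g.inner β) o β) x = w ∧
      ∃ h : Euc (m + 1) →L[ℝ] Euc (m + 1) →L[ℝ] ℝ, IsScalarProduct h ∧
      ∃ (b : Euc (m + 1)) (l : ℝ), b ≠ 0 ∧ 0 < l ∧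
      assocField (conformalMetric g.inner β) o β x = l • b ∧
      ∃ E : Euc (m + 1) → ℝ, E b = 0 ∧
      (interiorProd (assocField g.inner o β) (extD (starFlux g.inner o β)) x = 0 ↔ ∀ v, E v = 0) ∧
      ∀ v, h w v = l ^ 2 * E v + geodesicFactor g.inner o β x * (l * h b v) := by
    intro x hx
    have hz := mem_extChartAt_target (I := I) x
    have hmem : extChartAt I x x ∈ range I := mem_range_self _
    have hU : UniqueDiffWithinAt ℝ (range I) (extChartAt I x x) := I.uniqueDiffOn _ hmem
    have hNpos := normSq_pos o g hβ hx
    have hN := contDiffWithinAt_normSq o g hβ x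
    have hev := eventually_mem_nonvanishing hβ hx
    set z₀ := extChartAt I x x
    set h := bilinInChart x g.inner
    set b := vectorInChart x (assocField g.inner o β)
    have hl := contDiffWithinAt_volFactor hN hNpos
    have key := conformal_leviCivita (h := h) (b := b)
      (l := fun z => volFactor m (h z (b z) (b z))) hU
      ((contDiffWithinAt_range_of_target (contDiffOn_bilinInChart g x)).differentiableWithinAt
        (by norm_num))
      ((contDiffWithinAt_range_of_target
        (contDiffOn_vectorInChart_assocField o β g hβ x)).differentiableWithinAt (by norm_num))
      (hl.differentiableWithinAt (by norm_num)) (isScalarProduct_bilinInChart hg hz)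
      (fun h0 => hNpos.ne' (by rw [h0, map_zero])) (fun _ => rfl) (fun _ => rfl) (fun _ => rfl)
    have eX : vectorInChart x (assocField (conformalMetric g.inner β) o β) =ᶠ[𝓝[range I] z₀]
        fun z => volFactor m (h z (b z) (b z)) • b z :=
      hev.mono fun z hz => vectorInChart_conformalMetric hg o hz.1 hz.2
    have eG : bilinInChart x (conformalMetric g.inner β) =ᶠ[𝓝[range I] z₀]
        fun z => h z (b z) (b z) • h z :=
      hev.mono fun z hz => bilinInChart_conformalMetric hg o hz.1
    have eF : conformalSpeed g.inner β ∘ (extChartAt I x).symm =ᶠ[𝓝[range I] z₀]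
        fun z => h z (b z) (b z) * volFactor m (h z (b z) (b z)) :=
      hev.mono fun z hz => conformalSpeed_in_chart hg o hz.1
    -- The factor is dF(X)/F with X = l b and F = |b|² l, so `l` cancels and dF(b)/|b|² remains.
    have hρ : geodesicFactor g.inner o β x =
        fderivWithin ℝ (fun z => h z (b z) (b z) * volFactor m (h z (b z) (b z))) (range I) z₀
          (b z₀) / h z₀ (b z₀) (b z₀) := by
      have h1 := geodesicFactor_in_chart o g hβ hz (hev.self_of_nhdsWithin hmem).2
      rw [eF.fderivWithin_eq_of_mem hmem, eX.self_of_nhdsWithin hmem,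
        conformalSpeed_in_chart hg o hz, map_smul, smul_eq_mul,
        mul_comm _ (volFactor m _), mul_div_mul_left _ _ (volFactor_pos hNpos).ne',
        extChartAt_to_inv] at h1
      exact h1
    refine ⟨_, leviCivita_self _ _ x, h z₀, isScalarProduct_bilinInChart hg hz, b z₀,
      volFactor m (h z₀ (b z₀) (b z₀)), fun h0 => hNpos.ne' (by rw [h0, map_zero]),
      volFactor_pos hNpos, ?_,
      fun v => extDerivWithin (fun z => flatForm (h z) (b z)) (range I) z₀ ![b z₀, v], ?_,
      isForceFree_iff hg o x, fun v => ?_⟩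
    · exact (vectorInChart_self _ x).symm.trans (eX.self_of_nhdsWithin hmem)
    · exact ContinuousAlternatingMap.map_eq_zero_of_eq _ _ (i := 0) (j := 1) rfl (by decide)
    · rw [hρ, ← key v, eX.fderivWithin_eq_of_mem hmem, eG.fderivWithin_eq_of_mem hmem,
        eX.self_of_nhdsWithin hmem, eG.self_of_nhdsWithin hmem]
  constructor
  · intro hff
    refine ⟨geodesicFactor g.inner o β,
      fun x hx => (contMDiffAt_geodesicFactor o g hβ hx).contMDiffWithinAt, fun x hx => ?_⟩
    obtain ⟨w, hw, h, hh, b, l, -, -, hB, E, -, hE, key⟩ := main x hx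
    rw [hw, hB]
    refine eq_of_forall_apply_eq hh fun v => ?_
    rw [key, hE.1 (hff x hx) v]
    refine Eq.trans ?_ (congrArg (fun u => h u v)
      (smul_smul (geodesicFactor g.inner o β x) l b).symm)
    simp [mul_assoc]
  · rintro ⟨ρ, -, hρ⟩ x hx
    obtain ⟨w, hw, h, hh, b, l, hb, hl, hB, E, hEb, hE, key⟩ := main x hx
    refine hE.2 ?_
    have h1 : w = (ρ x * l) • b := by
      have := hρ x hx
      rw [hw, hB] at this
      exact this.trans (smul_smul (ρ x) l b)
    have h2 : ∀ v, ρ x * l * h b v =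
        l ^ 2 * E v + geodesicFactor g.inner o β x * (l * h b v) := by
      intro v
      rw [← key, h1]
      simp
    -- Testing with v = b removes `E` and determines ρ, since h(b, b) > 0. Substituting this ρ back
    -- then kills `E` on every vector.
    have hbb := hh.pos b hb
    have h3 : ρ x = geodesicFactor g.inner o β x := by
      have := h2 b
      rw [hEb] at this
      have h4 : (ρ x - geodesicFactor g.inner o β x) * (l * h b b) = 0 := by linear_combination this
      exact sub_eq_zero.1 ((mul_eq_zero.1 h4).resolve_right (mul_pos hl hbb).ne')
    intro v
    have := h2 v
    rw [h3] at this
    have h4 : l ^ 2 * E v = 0 := by linear_combination -this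
    exact (mul_eq_zero.1 h4).resolve_left (pow_pos hl 2).ne'

end Geodesic

end

end FluxForm

theorem mainTheorem1 {m : ℕ} (hm : 3 ≤ m + 1)
    {H : Type*} [TopologicalSpace H] {I : ModelWithCorners ℝ (EuclideanSpace ℝ (Fin (m + 1))) H}
    {M : Type*} [TopologicalSpace M] [ChartedSpace H M] [IsManifold I ∞ M]
    -- the boundary of `M`, a manifold without boundary, with its inclusion `j`
    {N : Type*} [TopologicalSpace N] [ChartedSpace (EuclideanSpace ℝ (Fin m)) N]
    [IsManifold (𝓡 m) ∞ N] (j : N → M) (hj : Manifold.IsSmoothEmbedding (𝓡 m) I ∞ j)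
    (hjM : range j = I.boundary M)
    (o : FluxForm.TangentOrientation I M)
    (ghat : Bundle.ContMDiffRiemannianMetric I ∞ (EuclideanSpace ℝ (Fin (m + 1)))
      (fun x : M => TangentSpace I x))
    -- the closed flux form `β`, with boundary values `βN`
    (β : FluxForm.DForm I M m) (hβ : FluxForm.SmoothOn β univ)
    (hclosed : ∀ x, FluxForm.extD β x = 0)
    (βN : FluxForm.DForm (𝓡 m) N m)
    (hβN : ∀ y, (β (j y)).compContinuousLinearMap (mfderiv (𝓡 m) I j y) = βN y) :
    (FluxForm.IsForceFreeOn ghat.inner o β (FluxForm.nonvanishing β) ↔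
      FluxForm.IsGeodesicOn (FluxForm.conformalMetric ghat.inner β) o β (FluxForm.nonvanishing β)) ∧
    (FluxForm.IsHarmonicOn ghat.inner o β (FluxForm.nonvanishing β) ↔
      FluxForm.IsEikonalOn (FluxForm.conformalMetric ghat.inner β) o β (FluxForm.nonvanishing β)) ∧
    (FluxForm.IsExactHarmonicOn ghat.inner o β (FluxForm.nonvanishing β) ↔
      FluxForm.IsExactEikonalOn (FluxForm.conformalMetric ghat.inner β) o β (FluxForm.nonvanishing β)) := by
  have hg := FluxForm.isScalarProduct_inner ghat
  have : IsManifold I 1 M := IsManifold.of_le (n := ∞) (by norm_num)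
  exact ⟨FluxForm.isForceFreeOn_iff_isGeodesicOn o ghat hβ,
    FluxForm.isHarmonicOn_iff_isEikonalOn hg hβ (FluxForm.smoothOn_starFlux o β ghat hβ _),
    FluxForm.isExactHarmonicOn_iff_isExactEikonalOn hg⟩
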